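/- Let $n\ge 2$ and let $T=E_0E_1\cdots E_n$ be a totally asymptotic (all vertices ideal) regular simplex in hyperbolic $n$-space $\mathbf H^n$ of curvature $-1$, where regular means that the symmetry group of $T$ acts transitively on the faces of $T$ of each dimension. Call $\mathcal B=(B_0,\dots,B_n)$ an admissible arrangement if each $B_i$ is a closed horoball centred at $E_i$, the $B_i$ have pairwise disjoint interiors, and each $B_i$ meets the hyperplane spanned by the vertices $E_j$, $j\ne i$, in at most one point. The generalized simplicial density of $\mathcal B$ is $$\delta(\mathcal B)=\frac{\sum_{i=0}^n \mathrm{vol}(B_i\cap T)}{\mathrm{vol}(T)},$$ where $0<\mathrm{vol}(T)<\infty$. An admissible arrangement is optimal if its density is maximal among all admissible arrangements. Let $\mathcal B_0^n$ be the arrangement of horoballs centred at the vertices that are of the same type ($\mathrm{vol}(B_i\cap T)$ does not depend on $i$) and any two of which are tangent. For a vertex $E_k$, let $\mathcal B_1^n$ (with large horoball at $E_k$) be the arrangement of horoballs centred at the vertices in which $B_k$ is tangent to the hyperplane of the opposite face of $T$ and every other $B_i$ is tangent to $B_k$. Let $q_n=\log\sqrt{2n/(n-1)}$. Let $d_n(\infty)=(n+1)\,\mathrm{vol}(B\cap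 T')/\mathrm{vol}(T')$, where $B$ is one of $n+1$ mutually tangent horoballs of the same type centred at the vertices of a totally asymptotic regular simplex $T'$. Then: 1. $\mathcal B_0^n$ exists and is unique, and for each $k$ the arrangement $\mathcal B_1^n$ with large horoball at $E_k$ exists and is unique. For $i\ne k$, the hyperbolic distance between the tangency point of $B_i$ and $B_k$ in $\mathcal B_0^n$ and that in $\mathcal B_1^n$ (with large horoball at $E_k$) is $q_n$. 2. If $n=2$ or $n=3$, then $q_n=\frac{1}{n-1}\log n$, and the optimal arrangements are exactly $\mathcal B_0^n$ and the arrangements $\mathcal B_1^n$ (with large horoball at any of the vertices). 3. If $n\ge 4$, then $q_n>\frac1{n-1}\log n$, and the optimal arrangements are exactly the arrangements $\mathcal B_1^n$ (with large horoball at any of the vertices). 4. The number $d_n(\infty)$ is well defined (it does not depend on the choices), and if $n\ge4$ then $\delta(\mathcal B)>d_n(\infty)$ for every optimal arrangement $\mathcal B$. -/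

import Mathlib

open scoped ENNReal

namespace HoroballSimplex

noncomputable section

/-- The vector space underlying the Lorentz space `E^{1,n}`. -/
abbrev LVec (n : ℕ) : Type := Fin (n + 1) → ℝ

/-- The Lorentz form `-x⁰y⁰ + x¹y¹ + ⋯ + xⁿyⁿ`. -/
def lor {n : ℕ} (x y : LVec n) : ℝ :=
  -(x 0 * y 0) + ∑ i : Fin n, x i.succ * y i.succ

/-- Hyperbolic `n`-space of curvature `-1`. Each proper point of the projective model is
represented by its unique representative with `⟨x, x⟩ = -1` and `x⁰ > 0`; the topology is the
subspace topology. -/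
def Hyp (n : ℕ) : Type := {x : LVec n // lor x x = -1 ∧ 0 < x 0}

instance (n : ℕ) : TopologicalSpace (Hyp n) :=
  inferInstanceAs (TopologicalSpace {x : LVec n // lor x x = -1 ∧ 0 < x 0})

/-- The hyperbolic distance, `cosh s = -⟨x, y⟩`. -/
def hdist {n : ℕ} (x y : Hyp n) : ℝ := Real.arcosh (-(lor x.1 y.1))

/-- Hyperbolic volume. In polar form `v = r • x` (`r > 0`, `x` on the hyperboloid), Lebesgue
measure on the future cone is `rⁿ dr dvol(x)`, so the volume of `A` is `n + 1` times the Lebesgue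
measure of the cone over `A` (as for the surface measure `MeasureTheory.Measure.toSphere`). -/
def hypVol {n : ℕ} (A : Set (Hyp n)) : ℝ≥0∞ :=
  (n + 1 : ℝ≥0∞) *
    MeasureTheory.volume {v : LVec n | ∃ x ∈ A, ∃ r : ℝ, 0 < r ∧ r ≤ 1 ∧ v = r • x.1}

/-- Isometries of hyperbolic space: the linear automorphisms that preserve the Lorentz form and
the sheet `Hyp n`. They act on the ideal points too. -/
def IsIsometry {n : ℕ} (g : LVec n ≃ₗ[ℝ] LVec n) : Prop :=
  (∀ x y, lor (g x) (g y) = lor x y) ∧ ∀ x : Hyp n, 0 < (g x.1) 0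

/-- `e` represents an ideal point: it is a light-like vector with `e⁰ > 0`. Positive multiples
represent the same ideal point. -/
def IsIdealPoint {n : ℕ} (e : LVec n) : Prop := lor e e = 0 ∧ 0 < e 0

/-- `B` is a (closed) horoball centred at the ideal point `[e]`. -/
def IsHoroball {n : ℕ} (e : LVec n) (B : Set (Hyp n)) : Prop :=
  ∃ t : ℝ, 0 < t ∧ B = {x : Hyp n | -(lor x.1 e) ≤ t}

/-- `E` lists the vertices of a (nondegenerate) totally asymptotic simplex. -/
def IsIdealSimplex {n : ℕ} (E : Fin (n + 1) → LVec n) : Prop :=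
  (∀ i, IsIdealPoint (E i)) ∧ LinearIndependent ℝ E

/-- The proper points of the simplex with ideal vertices `E`, the hyperbolic convex hull. -/
def simplex {n : ℕ} (E : Fin (n + 1) → LVec n) : Set (Hyp n) :=
  {x | ∃ a : Fin (n + 1) → ℝ, (∀ i, 0 ≤ a i) ∧ x.1 = ∑ i, a i • E i}

/-- The hyperplane through all vertices other than `E i`. -/
def oppositeHyperplane {n : ℕ} (E : Fin (n + 1) → LVec n) (i : Fin (n + 1)) : Set (Hyp n) :=
  {x | x.1 ∈ Submodule.span ℝ (E '' {j | j ≠ i})}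

/-- The isometry `g` is a symmetry of the simplex, inducing the permutation `σ` of its vertices. -/
def IsSymmetry {n : ℕ} (E : Fin (n + 1) → LVec n) (g : LVec n ≃ₗ[ℝ] LVec n)
    (σ : Equiv.Perm (Fin (n + 1))) : Prop :=
  IsIsometry g ∧ ∀ i, ∃ c : ℝ, 0 < c ∧ g (E i) = c • E (σ i)

/-- A totally asymptotic simplex is regular if its symmetry group acts transitively on its faces
of each dimension; a `k`-face is given by its set of `k + 1` vertices. -/
def IsRegularIdealSimplex {n : ℕ} (E : Fin (n + 1) → LVec n) : Prop :=
  IsIdealSimplex E ∧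
    ∀ S S' : Finset (Fin (n + 1)), S.card = S'.card →
      ∃ g σ, IsSymmetry E g σ ∧ S.image σ = S'

/-- Two sets touch: they meet in exactly one point. For horoballs with different centres, and for
a horoball and a hyperplane not through its centre, this is tangency (`n ≥ 2`). -/
def Touch {n : ℕ} (A B : Set (Hyp n)) : Prop := ∃ p, A ∩ B = {p}

/-- The horoball arrangements admitted in the generalized simplicial density: horoballs centred
at the vertices that do not overlap and each of which meets the hyperplane of the opposite face
in at most one point. -/
structure IsAdmissible {n : ℕ} (E : Fin (n + 1) → LVec n) (B : Fin (n + 1) → Set (Hyp n)) :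
    Prop where
  horoball : ∀ i, IsHoroball (E i) (B i)
  packing : ∀ i j, i ≠ j → Disjoint (interior (B i)) (interior (B j))
  face : ∀ i, (B i ∩ oppositeHyperplane E i).encard ≤ 1

/-- The generalized simplicial density `(∑ vol (B i ∩ T)) / vol T`. -/
def density {n : ℕ} (E : Fin (n + 1) → LVec n) (B : Fin (n + 1) → Set (Hyp n)) : ℝ :=
  (∑ i, (hypVol (B i ∩ simplex E)).toReal) / (hypVol (simplex E)).toReal

/-- `B` attains the maximal generalized simplicial density. -/
def IsOptimal {n : ℕ} (E : Fin (n + 1) → LVec n) (B : Fin (n + 1) → Set (Hyp n)) : Prop :=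
  IsAdmissible E B ∧ ∀ B', IsAdmissible E B' → density E B' ≤ density E B

/-- The configuration `B_0^n`: horoballs of the same type (equal volumes in the simplex), any two
of which touch. -/
structure IsEqualType {n : ℕ} (E : Fin (n + 1) → LVec n) (B : Fin (n + 1) → Set (Hyp n)) :
    Prop where
  horoball : ∀ i, IsHoroball (E i) (B i)
  same_type : ∀ i j, hypVol (B i ∩ simplex E) = hypVol (B j ∩ simplex E)
  touch : ∀ i j, i ≠ j → Touch (B i) (B j)

/-- The configuration `B_1^n` with the large horoball at `E k`: it touches the opposite face, and
all other horoballs touch it. -/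
structure IsOneMaximal {n : ℕ} (E : Fin (n + 1) → LVec n) (k : Fin (n + 1))
    (B : Fin (n + 1) → Set (Hyp n)) : Prop where
  horoball : ∀ i, IsHoroball (E i) (B i)
  touch_face : Touch (B k) (oppositeHyperplane E k)
  touch : ∀ i, i ≠ k → Touch (B i) (B k)

/-- `d` is the simplicial horoball density `d_n(∞) = (n + 1) vol (B ∩ T) / vol T`, where `B` is one
of `n + 1` mutually tangent horoballs of the same type and `T` is the regular simplex spanned by
their centres. -/
def IsClassicalDensity (n : ℕ) (d : ℝ) : Prop :=
  ∃ (E : Fin (n + 1) → LVec n) (B : Fin (n + 1) → Set (Hyp n)),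
    IsRegularIdealSimplex E ∧ IsEqualType E B ∧
      ∀ i, d = (n + 1) * ((hypVol (B i ∩ simplex E)).toReal / (hypVol (simplex E)).toReal)

/-- `q_n = log √(2n/(n-1))`. -/
def q (n : ℕ) : ℝ := Real.log (√(2 * n / (n - 1)))

end

end HoroballSimplex

namespace HoroballSimplex

/-! Regularity allows the vertices to be represented by light-like vectors `u i` with all products
of distinct ones equal to -1 (`exists_isNormalized`). A horoball at vertex i is then `-⟨x, u i⟩ ≤
t`, and an arrangement is a tuple of positive parameters t_i.

On the hyperboloid the product of `-⟨x, u i⟩` and `-⟨x, u j⟩` is at least 1/2, with equality exactly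
on the geodesic joining the two vertices. So two horoballs have disjoint interiors iff t_i t_j ≤ 1/2
and touch iff t_i t_j = 1/2 (`disjoint_interior_iff`, `touch_iff`). By Cauchy–Schwarz the minimum of
`-⟨x, u i⟩` on the opposite hyperplane is √(n/(n-1)), attained at one point only, which caps t_i
(`encard_face_le_one_iff`).

Below this cap a horoball leaves the simplex only through the faces at its own vertex, so a Fubini
and scaling argument shows that it cuts out a volume proportional to t_i^(n-1), with a ratio to the
volume of the simplex that depends only on n (`volume_slab`, `ratio_eq`).

With x_i = (√2 t_i)^(n-1) the problem is to maximise Σ x_i subject to x_i x_j ≤ 1 and x_i ≤ M, where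
M = √(2n/(n-1))^(n-1), that is, log M = (n-1) q_n. If all x_i ≤ 1 the sum is at most n + 1;
otherwise the largest, x, forces the others below 1/x, and x + n/x ≤ M + n/M because M ≥ n
(`sum_le_of_pairwise_mul_le_one`). The value M + n/M belongs to the arrangements with one large
horoball; it equals the value n + 1 of the equal arrangement iff M = n. Finally M = n for n = 2, 3
and M > n for n ≥ 4. -/

/-! ### The Lorentz form and its sign on ideal points -/

theorem lor_comm {n : ℕ} (x y : LVec n) : lor x y = lor y x := by
  simp only [lor, mul_comm]

theorem lor_add_left {n : ℕ} (x y z : LVec n) : lor (x + y) z = lor x z + lor y z := by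
  simp only [lor, Pi.add_apply, add_mul, Finset.sum_add_distrib]
  ring

theorem lor_smul_left {n : ℕ} (c : ℝ) (x z : LVec n) : lor (c • x) z = c * lor x z := by
  simp only [lor, Pi.smul_apply, smul_eq_mul, mul_assoc, ← Finset.mul_sum]
  ring

theorem lor_smul_right {n : ℕ} (c : ℝ) (x z : LVec n) : lor x (c • z) = c * lor x z := by
  rw [lor_comm, lor_smul_left, lor_comm]

theorem lor_neg_left {n : ℕ} (x z : LVec n) : lor (-x) z = -lor x z := by
  rw [← neg_one_smul ℝ x, lor_smul_left]
  ring

theorem lor_neg_right {n : ℕ} (x z : LVec n) : lor x (-z) = -lor x z := by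
  rw [lor_comm, lor_neg_left, lor_comm]

theorem lor_zero_left {n : ℕ} (z : LVec n) : lor 0 z = 0 := by
  simp [lor]

theorem lor_sum_left {n : ℕ} {ι : Type*} (s : Finset ι) (f : ι → LVec n) (z : LVec n) :
    lor (∑ i ∈ s, f i) z = ∑ i ∈ s, lor (f i) z := by
  classical
  induction s using Finset.induction_on with
  | empty => simp [lor_zero_left]
  | insert a s ha ih => rw [Finset.sum_insert ha, Finset.sum_insert ha, lor_add_left, ih]

theorem continuous_lor_left {n : ℕ} (z : LVec n) : Continuous fun x : LVec n => lor x z := by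
  unfold lor
  fun_prop

/-- A Lagrange-type identity for the Lorentz form. -/
theorem neg_two_mul_lor_eq {n : ℕ} (x y : LVec n) :
    -(2 * (x 0 * y 0) * lor x y) =
      ∑ i : Fin n, (y 0 * x i.succ - x 0 * y i.succ) ^ 2 - (y 0) ^ 2 * lor x x
        - (x 0) ^ 2 * lor y y := by
  have h : ∑ i : Fin n, (y 0 * x i.succ - x 0 * y i.succ) ^ 2 =
      (y 0) ^ 2 * ∑ i : Fin n, x i.succ * x i.succ
        - 2 * (x 0 * y 0) * ∑ i : Fin n, x i.succ * y i.succ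
        + (x 0) ^ 2 * ∑ i : Fin n, y i.succ * y i.succ := by
    rw [Finset.mul_sum, Finset.mul_sum, Finset.mul_sum, ← Finset.sum_sub_distrib,
      ← Finset.sum_add_distrib]
    exact Finset.sum_congr rfl fun i _ => by ring
  rw [h]
  simp only [lor]
  ring

theorem lor_neg_of_mem_of_isIdealPoint {n : ℕ} {x e : LVec n} (hx : lor x x = -1)
    (hx0 : 0 < x 0) (he : IsIdealPoint e) : lor x e < 0 := by
  have h := neg_two_mul_lor_eq x e
  rw [hx, he.1] at h
  have h1 : 0 ≤ ∑ i : Fin n, (e 0 * x i.succ - x 0 * e i.succ) ^ 2 :=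
    Finset.sum_nonneg fun i _ => sq_nonneg _
  have h2 : 0 < x 0 * e 0 := mul_pos hx0 he.2
  have h3 : 0 < (e 0) ^ 2 := pow_pos he.2 2
  by_contra! hc
  nlinarith [mul_nonneg h2.le hc]

theorem lor_neg_of_isIdealPoint {n : ℕ} {e f : LVec n} (he : IsIdealPoint e)
    (hf : IsIdealPoint f) (hef : f 0 • e ≠ e 0 • f) : lor e f < 0 := by
  have h := neg_two_mul_lor_eq e f
  rw [he.1, hf.1] at h
  have h2 : 0 < e 0 * f 0 := mul_pos he.2 hf.2
  by_contra! hc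
  have h1 : 0 ≤ ∑ i : Fin n, (f 0 * e i.succ - e 0 * f i.succ) ^ 2 :=
    Finset.sum_nonneg fun i _ => sq_nonneg _
  have h3 : ∑ i : Fin n, (f 0 * e i.succ - e 0 * f i.succ) ^ 2 = 0 := by
    nlinarith [mul_nonneg h2.le hc]
  rw [Finset.sum_eq_zero_iff_of_nonneg fun i _ => sq_nonneg _] at h3
  apply hef
  funext j
  refine Fin.cases ?_ (fun i => ?_) j
  · simp [mul_comm]
  · have := h3 i (Finset.mem_univ i)
    simpa [sub_eq_zero] using this

theorem IsIdealPoint.smul {n : ℕ} {e : LVec n} (he : IsIdealPoint e) {c : ℝ} (hc : 0 < c) :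
    IsIdealPoint (c • e) := by
  refine ⟨by rw [lor_smul_left, lor_smul_right, he.1]; ring, ?_⟩
  simpa using mul_pos hc he.2

/-! ### Normalizing the vertices of a regular simplex -/

/-- The vertices of a regular ideal simplex, represented by light-like vectors whose pairwise
Lorentz products are all equal to `-1`. -/
structure IsNormalized {n : ℕ} (u : Fin (n + 1) → LVec n) : Prop where
  ideal : ∀ i, IsIdealPoint (u i)
  linearIndependent : LinearIndependent ℝ u
  lor_eq : ∀ i j, i ≠ j → lor (u i) (u j) = -1

/-- A weight function on pairs that is invariant under a 2-homogeneous family of permutations up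
to a coboundary is itself a coboundary plus a constant. -/
theorem exists_eq_add_const_of_homogeneous {m : ℕ} (hm : 3 ≤ m) (l : Fin m → Fin m → ℝ)
    (hsymm : ∀ i j, l i j = l j i)
    (h : ∀ S S' : Finset (Fin m), S.card = S'.card → ∃ (σ : Equiv.Perm (Fin m)) (a : Fin m → ℝ),
      (∀ i j, i ≠ j → l i j = a i + a j + l (σ i) (σ j)) ∧ S.image σ = S') :
    ∃ (b : Fin m → ℝ) (K : ℝ), ∀ i j, i ≠ j → l i j = b i + b j + K := by
  classical
  have hm' : (0 : ℝ) < (m : ℝ) - 2 := by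
    have : (3 : ℝ) ≤ m := by exact_mod_cast hm
    linarith
  set s : Fin m → ℝ := fun i => ∑ j ∈ Finset.univ.erase i, l i j with hs
  -- The row sums `s` recover the coboundary: each shift `a i` is determined by how `s` changes
  -- under `σ`, so the row sums can be used to cancel it.
  have key : ∀ (σ : Equiv.Perm (Fin m)) (a : Fin m → ℝ),
      (∀ i j, i ≠ j → l i j = a i + a j + l (σ i) (σ j)) →
      ∀ i, s i = ((m : ℝ) - 2) * a i + s (σ i) := by
    intro σ a ha
    have h1 : ∀ i, s i = ((m : ℝ) - 2) * a i + ∑ j, a j + s (σ i) := by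
      intro i
      have e1 : s i = ∑ j ∈ Finset.univ.erase i, (a i + a j + l (σ i) (σ j)) :=
        Finset.sum_congr rfl fun j hj => ha i j (Finset.ne_of_mem_erase hj).symm
      have e2 : ∑ j ∈ Finset.univ.erase i, l (σ i) (σ j) = s (σ i) := by
        refine Finset.sum_bij (fun j _ => σ j) ?_ ?_ ?_ ?_
        · intro j hj
          simpa using hj
        · intro j _ k _ hjk
          exact σ.injective hjk
        · intro j hj
          exact ⟨σ.symm j, by
            simp only [Finset.mem_erase, Finset.mem_univ, and_true, ne_eq] at hj ⊢
            rintro rfl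
            simp at hj, by simp⟩
        · intro j _
          rfl
      have e3 : a i + ∑ j ∈ Finset.univ.erase i, a j = ∑ j, a j :=
        Finset.add_sum_erase _ _ (Finset.mem_univ i)
      rw [e1, Finset.sum_add_distrib, Finset.sum_add_distrib, e2, Finset.sum_const,
        Finset.card_erase_of_mem (Finset.mem_univ i), Finset.card_univ, Fintype.card_fin,
        nsmul_eq_mul, Nat.cast_sub (by omega), Nat.cast_one]
      linarith
    have h2 : ∑ i, s i = ((m : ℝ) - 2) * ∑ i, a i + m * ∑ j, a j + ∑ i, s i := by
      calc ∑ i, s i = ∑ i, (((m : ℝ) - 2) * a i + ∑ j, a j + s (σ i)) :=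
            Finset.sum_congr rfl fun i _ => h1 i
        _ = _ := by
            rw [Finset.sum_add_distrib, Finset.sum_add_distrib, ← Finset.mul_sum,
              Equiv.sum_comp σ s, Finset.sum_const, Finset.card_univ, Fintype.card_fin,
              nsmul_eq_mul]
    -- Summing `h1` over i, the row sums cancel, since σ only permutes them.
    have h3 : ∑ j, a j = 0 := by
      have : (2 * ((m : ℝ) - 1)) * ∑ j, a j = 0 := by linarith
      rcases mul_eq_zero.1 this with h | h
      · exfalso
        linarith
      · exact h
    intro i
    rw [h1 i, h3]
    ring
  -- Corrected by the row sums, the weight is invariant under every σ, hence constant because the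
  -- pairs form one orbit.
  have inv : ∀ i j i' j', i ≠ j → i' ≠ j' →
      l i j - (s i + s j) / ((m : ℝ) - 2) = l i' j' - (s i' + s j') / ((m : ℝ) - 2) := by
    intro i j i' j' hij hij'
    obtain ⟨σ, a, ha, hS⟩ := h {i, j} {i', j'} (by
      rw [Finset.card_pair hij, Finset.card_pair hij'])
    have hk := key σ a ha
    have h1 : l i j - (s i + s j) / ((m : ℝ) - 2) =
        l (σ i) (σ j) - (s (σ i) + s (σ j)) / ((m : ℝ) - 2) := by
      rw [ha i j hij, hk i, hk j]
      field_simp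
      ring
    rw [h1]
    have hi : σ i ∈ ({i', j'} : Finset (Fin m)) := by
      rw [← hS]
      simp
    have hj : σ j ∈ ({i', j'} : Finset (Fin m)) := by
      rw [← hS]
      simp
    have hne : σ i ≠ σ j := fun hc => hij (σ.injective hc)
    simp only [Finset.mem_insert, Finset.mem_singleton] at hi hj
    rcases hi with hi | hi <;> rcases hj with hj | hj
    · exact absurd (hi.trans hj.symm) hne
    · rw [hi, hj]
    · rw [hi, hj, hsymm, add_comm (s j')]
    · exact absurd (hi.trans hj.symm) hne
  have h01 : (⟨0, by omega⟩ : Fin m) ≠ ⟨1, by omega⟩ := by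
    intro hc
    simp at hc
  refine ⟨fun i => s i / ((m : ℝ) - 2), l ⟨0, by omega⟩ ⟨1, by omega⟩ -
    (s ⟨0, by omega⟩ + s ⟨1, by omega⟩) / ((m : ℝ) - 2), fun i j hij => ?_⟩
  rw [← inv i j _ _ hij h01]
  ring

/-- A symmetry permutes the vertices up to positive factors, so the logarithms of the products `-⟨E
i, E j⟩` are invariant up to a coboundary. They are therefore of the form b_i + b_j + K, which
rescaling the vertices removes. Only transitivity on edges matters. -/
theorem IsRegularIdealSimplex.exists_isNormalized {n : ℕ} (hn : 2 ≤ n)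
    {E : Fin (n + 1) → LVec n} (hE : IsRegularIdealSimplex E) :
    ∃ c : Fin (n + 1) → ℝ, (∀ i, 0 < c i) ∧ IsNormalized fun i => c i • E i := by
  obtain ⟨⟨hid, hli⟩, hreg⟩ := hE
  have hneg : ∀ i j, i ≠ j → 0 < -lor (E i) (E j) := by
    intro i j hij
    have := lor_neg_of_isIdealPoint (hid i) (hid j) (fun hc => by
      have h2 := Fintype.linearIndependent_iff.1 hli
        (Pi.single i (E j 0) - Pi.single j (E i 0)) (by
          simp [sub_smul, Finset.sum_sub_distrib, Pi.single_apply, ite_smul, hc]) i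
      simp [hij] at h2
      exact (hid j).2.ne' h2)
    linarith
  obtain ⟨b, K, hb⟩ := exists_eq_add_const_of_homogeneous (m := n + 1) (by omega)
    (fun i j => Real.log (-lor (E i) (E j))) (fun i j => by simp only [lor_comm]) (by
      intro S S' hS
      obtain ⟨g, σ, ⟨hg, hc⟩, hσ⟩ := hreg S S' hS
      choose c hc0 hc using hc
      refine ⟨σ, fun i => Real.log (c i), fun i j hij => ?_, hσ⟩
      have hσij : σ i ≠ σ j := fun h => hij (σ.injective h)
      rw [← hg.1 (E i) (E j), hc i, hc j, lor_smul_left, lor_smul_right,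
        show -(c i * (c j * lor (E (σ i)) (E (σ j)))) =
          c i * c j * (-lor (E (σ i)) (E (σ j))) by ring,
        Real.log_mul (mul_pos (hc0 i) (hc0 j)).ne' (hneg _ _ hσij).ne',
        Real.log_mul (hc0 i).ne' (hc0 j).ne'])
  refine ⟨fun i => Real.exp (-b i - K / 2), fun i => Real.exp_pos _, fun i =>
    (hid i).smul (Real.exp_pos _), ?_, fun i j hij => ?_⟩
  · exact hli.units_smul fun i => Units.mk0 _ (Real.exp_pos (-b i - K / 2)).ne'
  · have h1 : lor (E i) (E j) = -Real.exp (b i + b j + K) := by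
      rw [← hb i j hij, Real.exp_log (hneg i j hij)]
      ring
    rw [lor_smul_left, lor_smul_right, h1, mul_neg, mul_neg, ← Real.exp_add, ← Real.exp_add]
    simp only [neg_inj, Real.exp_eq_one_iff]
    ring

/-! ### Horoballs and the Lorentz form in barycentric coordinates -/

/-- The closed horoball `{x | -⟨x, e⟩ ≤ t}`. -/
def horo {n : ℕ} (e : LVec n) (t : ℝ) : Set (Hyp n) := {x : Hyp n | -(lor x.1 e) ≤ t}

theorem pos_of_lor_neg {n : ℕ} {v e : LVec n} (hv : lor v v = -1) (he : IsIdealPoint e)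
    (hve : lor v e < 0) : 0 < v 0 := by
  by_contra! hc
  rcases hc.lt_or_eq with h | h
  · have := lor_neg_of_mem_of_isIdealPoint (x := -v) (e := e)
      (by rw [lor_neg_left, lor_neg_right, hv]; ring) (by simpa using h) he
    rw [lor_neg_left] at this
    linarith
  · simp only [lor, h] at hv
    have : 0 ≤ ∑ i : Fin n, v i.succ * v i.succ :=
      Finset.sum_nonneg fun i _ => mul_self_nonneg _
    linarith

theorem continuous_lor_val {n : ℕ} (e : LVec n) : Continuous fun x : Hyp n => lor x.1 e :=
  (continuous_lor_left e).comp continuous_subtype_val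

theorem lor_sum_smul_left {n : ℕ} {u : Fin (n + 1) → LVec n} (hu : IsNormalized u)
    (a : Fin (n + 1) → ℝ) (j : Fin (n + 1)) :
    lor (∑ i, a i • u i) (u j) = a j - ∑ i, a i := by
  have h : ∀ i, lor (a i • u i) (u j) = (if i = j then a i else 0) - a i := by
    intro i
    rw [lor_smul_left]
    split_ifs with hij
    · rw [hij, (hu.ideal j).1]
      ring
    · rw [hu.lor_eq i j hij]
      ring
  rw [lor_sum_left, Finset.sum_congr rfl fun i _ => h i, Finset.sum_sub_distrib]
  simp

theorem lor_sum_smul_self {n : ℕ} {u : Fin (n + 1) → LVec n} (hu : IsNormalized u)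
    (a : Fin (n + 1) → ℝ) :
    lor (∑ i, a i • u i) (∑ i, a i • u i) = ∑ i, a i ^ 2 - (∑ i, a i) ^ 2 := by
  rw [lor_sum_left]
  have h : ∀ i, lor (a i • u i) (∑ i, a i • u i) = a i ^ 2 - a i * ∑ i, a i := by
    intro i
    rw [lor_smul_left, lor_comm, lor_sum_smul_left hu]
    ring
  rw [Finset.sum_congr rfl fun i _ => h i, Finset.sum_sub_distrib, ← Finset.sum_mul]
  ring

theorem exists_ne_ne {m : ℕ} (hm : 2 ≤ m) (i : Fin (m + 1)) :
    ∃ j₁ j₂ : Fin (m + 1), j₁ ≠ i ∧ j₂ ≠ i ∧ j₁ ≠ j₂ := by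
  have h : 1 < (Finset.univ.erase i).card := by
    rw [Finset.card_erase_of_mem (Finset.mem_univ i), Finset.card_univ, Fintype.card_fin]
    omega
  obtain ⟨j₁, h1, j₂, h2, h12⟩ := Finset.one_lt_card.1 h
  exact ⟨j₁, j₂, Finset.ne_of_mem_erase h1, Finset.ne_of_mem_erase h2, h12⟩

/-! ### Two horoballs and the edge joining their centres -/

namespace IsNormalized

variable {n : ℕ} {u : Fin (n + 1) → LVec n}

theorem injective_linearCombination (hu : IsNormalized u) :
    Function.Injective (Fintype.linearCombination ℝ u) :=
  linearIndependent_iff_injective_fintypeLinearCombination.1 hu.linearIndependent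

theorem exists_coord (hu : IsNormalized u) (v : LVec n) :
    ∃ a : Fin (n + 1) → ℝ, v = ∑ i, a i • u i := by
  obtain ⟨a, ha⟩ :=
    LinearMap.injective_iff_surjective.1 hu.injective_linearCombination v
  exact ⟨a, by rw [← ha, Fintype.linearCombination_apply]⟩

/-- Quantitative form of the fact that the orthogonal complement of the Lorentzian plane spanned by
`u i` and `u j` is positive definite: orthogonality forces a_i = a_j = Σ a, so the square of the sum
is at most half the sum of squares. -/
theorem half_sum_sq_le (hu : IsNormalized u) {i j : Fin (n + 1)} (hij : i ≠ j)
    (a : Fin (n + 1) → ℝ) (hi : lor (∑ k, a k • u k) (u i) = 0)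
    (hj : lor (∑ k, a k • u k) (u j) = 0) :
    (∑ k, a k ^ 2) / 2 ≤ lor (∑ k, a k • u k) (∑ k, a k • u k) := by
  rw [lor_sum_smul_left hu, sub_eq_zero] at hi hj
  rw [lor_sum_smul_self hu]
  have h : ∑ k ∈ {i, j}, a k ^ 2 ≤ ∑ k, a k ^ 2 :=
    Finset.sum_le_univ_sum_of_nonneg fun k => sq_nonneg _
  rw [Finset.sum_pair hij, hi, hj] at h
  linarith

theorem lor_self_nonneg (hu : IsNormalized u) {i j : Fin (n + 1)} (hij : i ≠ j) {w : LVec n}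
    (hi : lor w (u i) = 0) (hj : lor w (u j) = 0) : 0 ≤ lor w w := by
  obtain ⟨a, rfl⟩ := hu.exists_coord w
  have h := hu.half_sum_sq_le hij a hi hj
  have : 0 ≤ ∑ k, a k ^ 2 := Finset.sum_nonneg fun k _ => sq_nonneg _
  linarith

theorem eq_zero_of_lor_self (hu : IsNormalized u) {i j : Fin (n + 1)} (hij : i ≠ j) {w : LVec n}
    (hi : lor w (u i) = 0) (hj : lor w (u j) = 0) (hw : lor w w = 0) : w = 0 := by
  obtain ⟨a, rfl⟩ := hu.exists_coord w
  have h := hu.half_sum_sq_le hij a hi hj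
  have h0 : 0 ≤ ∑ k, a k ^ 2 := Finset.sum_nonneg fun k _ => sq_nonneg _
  have h1 : ∑ k, a k ^ 2 = 0 := by linarith
  rw [Finset.sum_eq_zero_iff_of_nonneg fun k _ => sq_nonneg _] at h1
  exact Finset.sum_eq_zero fun k hk => by
    rw [pow_eq_zero_iff (two_ne_zero) |>.1 (h1 k hk), zero_smul]

theorem lor_comb (hu : IsNormalized u) {i j : Fin (n + 1)} (hij : i ≠ j) (r p : ℝ) :
    lor (r • u i + p • u j) (u i) = -p ∧ lor (r • u i + p • u j) (u j) = -r ∧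
      lor (r • u i + p • u j) (r • u i + p • u j) = -(2 * (r * p)) := by
  have h1 : lor (r • u i + p • u j) (u i) = -p := by
    rw [lor_add_left, lor_smul_left, lor_smul_left, (hu.ideal i).1, hu.lor_eq j i hij.symm]
    ring
  have h2 : lor (r • u i + p • u j) (u j) = -r := by
    rw [lor_add_left, lor_smul_left, lor_smul_left, (hu.ideal j).1, hu.lor_eq i j hij]
    ring
  refine ⟨h1, h2, ?_⟩
  rw [lor_add_left, lor_smul_left, lor_smul_left, lor_comm (u i), lor_comm (u j), h1, h2]
  ring

/-- The point of the edge `ij` with `-⟨x, u j⟩ = r` and `-⟨x, u i⟩ = p`. -/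
def edgePoint (hu : IsNormalized u) {i j : Fin (n + 1)} (hij : i ≠ j) (r p : ℝ) (hr : 0 < r)
    (hp : 0 < p) (hrp : r * p = 1 / 2) : Hyp n :=
  ⟨r • u i + p • u j, by rw [(hu.lor_comb hij r p).2.2, hrp]; norm_num, by
    have h1 := mul_pos hr (hu.ideal i).2
    have h2 := mul_pos hp (hu.ideal j).2
    simpa using add_pos h1 h2⟩

/-- Here `w` is the component of `x` orthogonal to the plane of `u i` and `u j`. For `x` on the
hyperboloid, nonnegativity of its square is the bound 1/2 on the product of the two horoball
functions, and `w = 0` characterises the points of the edge. -/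
theorem lor_residual (hu : IsNormalized u) {i j : Fin (n + 1)} (hij : i ≠ j) (x : LVec n) :
    let w := x + (lor x (u j) • u i + lor x (u i) • u j)
    lor w (u i) = 0 ∧ lor w (u j) = 0 ∧
      lor w w = lor x x + 2 * (lor x (u i) * lor x (u j)) := by
  intro w
  obtain ⟨h1, h2, h3⟩ := hu.lor_comb hij (lor x (u j)) (lor x (u i))
  have e1 : lor w (u i) = 0 := by
    rw [lor_add_left, h1]
    ring
  have e2 : lor w (u j) = 0 := by
    rw [lor_add_left, h2]
    ring
  refine ⟨e1, e2, ?_⟩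
  rw [lor_comm, lor_add_left, lor_add_left, lor_smul_left, lor_smul_left, lor_comm (u i),
    lor_comm (u j), e1, e2, lor_comm, lor_add_left, lor_add_left, lor_smul_left, lor_smul_left,
    lor_comm (u i), lor_comm (u j)]
  ring

theorem half_le_lor_mul_lor (hu : IsNormalized u) {i j : Fin (n + 1)} (hij : i ≠ j) (x : Hyp n) :
    1 / 2 ≤ -(lor x.1 (u i)) * -(lor x.1 (u j)) := by
  obtain ⟨h1, h2, h3⟩ := hu.lor_residual hij x.1
  have := hu.lor_self_nonneg hij h1 h2
  rw [h3, x.2.1] at this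
  linarith

theorem eq_of_lor_mul_lor (hu : IsNormalized u) {i j : Fin (n + 1)} (hij : i ≠ j) (x : Hyp n)
    (h : -(lor x.1 (u i)) * -(lor x.1 (u j)) = 1 / 2) :
    x.1 = (-(lor x.1 (u j))) • u i + (-(lor x.1 (u i))) • u j := by
  obtain ⟨h1, h2, h3⟩ := hu.lor_residual hij x.1
  have := hu.eq_zero_of_lor_self hij h1 h2 (by rw [h3, x.2.1]; linarith)
  rw [neg_smul, neg_smul, ← neg_add]
  exact eq_neg_of_add_eq_zero_left this

theorem neg_lor_pos (hu : IsNormalized u) (i : Fin (n + 1)) (x : Hyp n) :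
    0 < -(lor x.1 (u i)) := by
  have := lor_neg_of_mem_of_isIdealPoint x.2.1 x.2.2 (hu.ideal i)
  linarith

theorem lor_eq_of_mem_inter (hu : IsNormalized u) {i j : Fin (n + 1)} (hij : i ≠ j) {s t : ℝ}
    (hst : s * t ≤ 1 / 2) {x : Hyp n} (hi : x ∈ horo (u i) s) (hj : x ∈ horo (u j) t) :
    -(lor x.1 (u i)) = s ∧ -(lor x.1 (u j)) = t ∧ s * t = 1 / 2 := by
  have h1 := hu.half_le_lor_mul_lor hij x
  have h2 := hu.neg_lor_pos i x
  have h3 := hu.neg_lor_pos j x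
  have h4 : -(lor x.1 (u i)) ≤ s := hi
  have h5 : -(lor x.1 (u j)) ≤ t := hj
  have h6 : -(lor x.1 (u i)) = s := by
    by_contra hne
    have := mul_lt_mul_of_pos_right (lt_of_le_of_ne h4 hne) h3
    have := mul_le_mul_of_nonneg_left h5 (h2.le.trans h4)
    linarith
  have h7 : -(lor x.1 (u j)) = t := by
    by_contra hne
    have := mul_lt_mul_of_pos_left (lt_of_le_of_ne h5 hne) h2
    have := mul_le_mul_of_nonneg_right h4 (h3.le.trans h5)
    linarith
  refine ⟨h6, h7, le_antisymm hst ?_⟩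
  rw [h6, h7] at h1
  exact h1

theorem val_eq_of_mem_inter (hu : IsNormalized u) {i j : Fin (n + 1)} (hij : i ≠ j) {s t : ℝ}
    (hst : s * t ≤ 1 / 2) {x : Hyp n} (hi : x ∈ horo (u i) s) (hj : x ∈ horo (u j) t) :
    x.1 = t • u i + s • u j := by
  obtain ⟨h1, h2, h3⟩ := hu.lor_eq_of_mem_inter hij hst hi hj
  have := hu.eq_of_lor_mul_lor hij x (by rw [h1, h2, h3])
  rwa [h1, h2] at this

theorem lor_edgePoint (hu : IsNormalized u) {i j : Fin (n + 1)} (hij : i ≠ j) (r p : ℝ)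
    (hr : 0 < r) (hp : 0 < p) (hrp : r * p = 1 / 2) :
    -(lor (hu.edgePoint hij r p hr hp hrp).1 (u i)) = p ∧
      -(lor (hu.edgePoint hij r p hr hp hrp).1 (u j)) = r := by
  obtain ⟨h1, h2, -⟩ := hu.lor_comb hij r p
  constructor
  · change -(lor (r • u i + p • u j) (u i)) = p
    rw [h1, neg_neg]
  · change -(lor (r • u i + p • u j) (u j)) = r
    rw [h2, neg_neg]

theorem touch_iff (hu : IsNormalized u) {i j : Fin (n + 1)} (hij : i ≠ j) {s t : ℝ}
    (hs : 0 < s) (ht : 0 < t) : Touch (horo (u i) s) (horo (u j) t) ↔ s * t = 1 / 2 := by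
  constructor
  · rintro ⟨x, hx⟩
    have hmem : x ∈ horo (u i) s ∩ horo (u j) t := by
      rw [hx]
      rfl
    by_contra hne
    rcases lt_or_gt_of_ne hne with h | h
    · exact hne (hu.lor_eq_of_mem_inter hij h.le hmem.1 hmem.2).2.2
    -- If the horoballs overlap, the edge meets their intersection in a segment; `y` and `z` are its
    -- two ends, one on each horosphere.
    · have e1 : (1 / (2 * s)) * s = 1 / 2 := by field_simp
      have e2 : t * (1 / (2 * t)) = 1 / 2 := by field_simp
      have l1 : 1 / (2 * s) ≤ t := by
        rw [div_le_iff₀ (by positivity)]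
        linarith
      have l2 : 1 / (2 * t) < s := by
        rw [div_lt_iff₀ (by positivity)]
        linarith
      have m1 := hu.lor_edgePoint hij (1 / (2 * s)) s (by positivity) hs e1
      have m2 := hu.lor_edgePoint hij t (1 / (2 * t)) ht (by positivity) e2
      set y := hu.edgePoint hij (1 / (2 * s)) s (by positivity) hs e1
      set z := hu.edgePoint hij t (1 / (2 * t)) ht (by positivity) e2
      have hy : y ∈ horo (u i) s ∩ horo (u j) t := ⟨m1.1.le, m1.2.le.trans l1⟩
      have hz : z ∈ horo (u i) s ∩ horo (u j) t := ⟨m2.1.le.trans l2.le, m2.2.le⟩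
      rw [hx, Set.mem_singleton_iff] at hy hz
      rw [hy] at m1
      rw [hz, m1.1] at m2
      exact l2.ne' m2.1
  · intro h
    refine ⟨hu.edgePoint hij t s ht hs (by rw [mul_comm, h]), ?_⟩
    obtain ⟨h1, h2⟩ := hu.lor_edgePoint hij t s ht hs (by rw [mul_comm, h])
    ext x
    constructor
    · rintro ⟨hi, hj⟩
      exact Subtype.ext (hu.val_eq_of_mem_inter hij h.le hi hj)
    · rintro rfl
      exact ⟨h1.le, h2.le⟩

/-- From an edge point on the horosphere, an arbitrarily small move along the edge away from vertex
i leaves the horoball. Excluding tangency points from the topological interiors needs only this. -/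
theorem lor_lt_of_mem_interior (hu : IsNormalized u) {i j : Fin (n + 1)} (hij : i ≠ j) {s : ℝ}
    {x : Hyp n} (hx : x ∈ interior (horo (u i) s))
    (h : -(lor x.1 (u i)) * -(lor x.1 (u j)) = 1 / 2) : -(lor x.1 (u i)) < s := by
  have hp := hu.neg_lor_pos i x
  have hr := hu.neg_lor_pos j x
  set p := -(lor x.1 (u i)) with hpdef
  set r := -(lor x.1 (u j)) with hrdef
  have hle : p ≤ s := (interior_subset hx : x ∈ horo (u i) s)
  refine lt_of_le_of_ne hle fun heq => ?_
  let γ : ℝ → Hyp n := fun θ => hu.edgePoint hij (Real.exp (-θ) * r) (Real.exp θ * p)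
    (by positivity) (by positivity) (by
      rw [mul_mul_mul_comm, ← Real.exp_add, neg_add_cancel, Real.exp_zero, one_mul, mul_comm, h])
  have hγ : Continuous γ := by
    refine Continuous.subtype_mk ?_ _
    fun_prop
  have hγ0 : γ 0 = x := by
    refine Subtype.ext ?_
    rw [hu.eq_of_lor_mul_lor hij x h]
    simp [γ, edgePoint, hpdef, hrdef]
  have hopen : IsOpen (γ ⁻¹' interior (horo (u i) s)) := isOpen_interior.preimage hγ
  obtain ⟨ε, hε, hball⟩ := Metric.isOpen_iff.1 hopen 0 (by
    rw [Set.mem_preimage, hγ0]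
    exact hx)
  have hmem : ε / 2 ∈ Metric.ball (0 : ℝ) ε := by
    rw [Metric.mem_ball, Real.dist_eq, sub_zero, abs_of_pos (by linarith)]
    linarith
  have h2 : -(lor (γ (ε / 2)).1 (u i)) ≤ s :=
    (interior_subset (hball hmem) : γ (ε / 2) ∈ horo (u i) s)
  rw [(hu.lor_edgePoint hij _ _ _ _ _).1, ← heq] at h2
  have : 1 < Real.exp (ε / 2) := Real.one_lt_exp_iff.2 (by linarith)
  nlinarith

theorem disjoint_interior_iff (hu : IsNormalized u) {i j : Fin (n + 1)} (hij : i ≠ j) {s t : ℝ}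
    (hs : 0 < s) (ht : 0 < t) :
    Disjoint (interior (horo (u i) s)) (interior (horo (u j) t)) ↔ s * t ≤ 1 / 2 := by
  constructor
  · intro hd
    by_contra! hc
    have hsub : ∀ (k : Fin (n + 1)) (c : ℝ),
        {x : Hyp n | -(lor x.1 (u k)) < c} ⊆ interior (horo (u k) c) := fun k c =>
      interior_maximal (fun x (hx : -(lor x.1 (u k)) < c) => hx.le)
        (isOpen_lt (continuous_lor_val (u k)).neg continuous_const)
    -- Shrinking both parameters by this factor makes the smaller horoballs tangent; their tangency
    -- point lies strictly inside both original ones.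
    set θ := √(2 * (s * t)) with hθ
    have hθ1 : 1 < θ := by
      rw [hθ, Real.lt_sqrt (by norm_num)]
      linarith
    have hθ2 : θ * θ = 2 * (s * t) := Real.mul_self_sqrt (by positivity)
    have hθ3 : t / θ * (s / θ) = 1 / 2 := by
      rw [div_mul_div_comm, hθ2]
      field_simp
    have hm := hu.lor_edgePoint hij (t / θ) (s / θ) (by positivity) (by positivity) hθ3
    refine (Set.disjoint_left.1 hd :)
      (a := hu.edgePoint hij (t / θ) (s / θ) (by positivity) (by positivity) hθ3)
      (hsub i s ?_) (hsub j t ?_)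
    · rw [Set.mem_ofPred_eq, hm.1]
      exact div_lt_self hs hθ1
    · rw [Set.mem_ofPred_eq, hm.2]
      exact div_lt_self ht hθ1
  · intro h
    refine Set.disjoint_left.2 fun x hi hj => ?_
    obtain ⟨h1, h2, h3⟩ :=
      hu.lor_eq_of_mem_inter hij h (interior_subset hi) (interior_subset hj)
    exact (hu.lor_lt_of_mem_interior hij hi (by rw [h1, h2, h3])).ne h1

/-! ### A horoball and the opposite face -/

theorem coord_of_mem_oppositeHyperplane {i : Fin (n + 1)} {x : Hyp n}
    (hx : x ∈ oppositeHyperplane u i) :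
    ∃ a : Fin (n + 1) → ℝ, a i = 0 ∧ x.1 = ∑ k, a k • u k := by
  have hle : Submodule.span ℝ (u '' {j | j ≠ i}) ≤
      (LinearMap.ker (LinearMap.proj (R := ℝ) (φ := fun _ : Fin (n + 1) => ℝ) i)).map
        (Fintype.linearCombination ℝ u) := by
    rw [Submodule.span_le]
    rintro _ ⟨j, hj, rfl⟩
    refine ⟨Pi.single j 1, ?_, ?_⟩
    · simpa [Pi.single_apply] using fun h => hj h.symm
    · simp
  obtain ⟨a, ha, hax⟩ := hle hx
  exact ⟨a, by simpa using ha, by rw [← hax, Fintype.linearCombination_apply]⟩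

theorem eq_of_mem_face (hu : IsNormalized u) (hn : 2 ≤ n) {i : Fin (n + 1)} {t : ℝ}
    (ht : t ^ 2 * ((n : ℝ) - 1) ≤ n) {x : Hyp n}
    (hx : x ∈ horo (u i) t) (hxi : x ∈ oppositeHyperplane u i) :
    t ^ 2 * ((n : ℝ) - 1) = n ∧ x.1 = ∑ k ∈ Finset.univ.erase i, (t / n) • u k := by
  obtain ⟨a, hai, hax⟩ := coord_of_mem_oppositeHyperplane hxi
  have hn0 : (2 : ℝ) ≤ n := by exact_mod_cast hn
  have hp := hu.neg_lor_pos i x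
  have hxt : -(lor x.1 (u i)) ≤ t := hx
  have hself := x.2.1
  rw [hax, lor_sum_smul_left hu, hai, zero_sub, neg_neg] at hp hxt
  rw [hax, lor_sum_smul_self hu] at hself
  set S := ∑ k, a k with hS
  have e1 : ∑ k ∈ Finset.univ.erase i, a k = S := by
    rw [hS, ← Finset.add_sum_erase _ _ (Finset.mem_univ i), hai, zero_add]
  have e2 : ∑ k ∈ Finset.univ.erase i, a k ^ 2 = ∑ k, a k ^ 2 := by
    rw [← Finset.add_sum_erase Finset.univ (fun k => a k ^ 2) (Finset.mem_univ i), hai]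
    ring
  -- On this hyperplane `S` is the horoball function at `u i`. The variance form of Cauchy–Schwarz
  -- bounds it below by √(n/(n-1)), and vanishing variance identifies the nearest point.
  have e3 : ∑ k ∈ Finset.univ.erase i, (a k - S / n) ^ 2 = S ^ 2 * ((n : ℝ) - 1) / n - 1 := by
    have : ∀ k, (a k - S / n) ^ 2 = a k ^ 2 - 2 * (S / n) * a k + (S / n) ^ 2 := fun k => by ring
    simp only [this]
    rw [Finset.sum_add_distrib, Finset.sum_sub_distrib, ← Finset.mul_sum, e1, e2, Finset.sum_const,
      Finset.card_erase_of_mem (Finset.mem_univ i), Finset.card_univ, Fintype.card_fin,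
      nsmul_eq_mul, Nat.add_sub_cancel]
    have : ∑ k, a k ^ 2 = S ^ 2 - 1 := by linarith
    rw [this]
    field_simp
    ring
  have e4 : 0 ≤ ∑ k ∈ Finset.univ.erase i, (a k - S / n) ^ 2 :=
    Finset.sum_nonneg fun k _ => sq_nonneg _
  have e5 : S ^ 2 ≤ t ^ 2 := pow_le_pow_left₀ hp.le hxt 2
  have e6 : (n : ℝ) ≤ S ^ 2 * ((n : ℝ) - 1) := by
    rw [e3] at e4
    have : 1 ≤ S ^ 2 * ((n : ℝ) - 1) / n := by linarith
    rwa [le_div_iff₀ (by linarith), one_mul] at this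
  have e7 : S ^ 2 * ((n : ℝ) - 1) ≤ t ^ 2 * ((n : ℝ) - 1) :=
    mul_le_mul_of_nonneg_right e5 (by linarith)
  have e8 : S ^ 2 * ((n : ℝ) - 1) = n := by linarith
  have e9 : S = t := by
    have h : S ^ 2 = t ^ 2 := by
      have : (S ^ 2 - t ^ 2) * ((n : ℝ) - 1) = 0 := by linarith
      rcases mul_eq_zero.1 this with h | h
      · linarith
      · linarith
    exact (pow_left_inj₀ hp.le (hp.le.trans hxt) (by norm_num)).1 h
  refine ⟨by rw [← e9, e8], ?_⟩
  rw [e8, div_self (by linarith), sub_self] at e3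
  rw [Finset.sum_eq_zero_iff_of_nonneg fun k _ => sq_nonneg _] at e3
  rw [hax, ← Finset.add_sum_erase _ _ (Finset.mem_univ i), hai, zero_smul, zero_add]
  refine Finset.sum_congr rfl fun k hk => ?_
  have := e3 k hk
  rw [pow_eq_zero_iff (by norm_num), sub_eq_zero, e9] at this
  rw [this]

theorem lor_face_center (hu : IsNormalized u) (i j : Fin (n + 1)) :
    lor (∑ k ∈ Finset.univ.erase i, u k) (u j) = (if j = i then 0 else 1) - n := by
  have h : ∀ k, lor (u k) (u j) = (if k = j then 1 else 0) - 1 := by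
    intro k
    split_ifs with hkj
    · rw [hkj, (hu.ideal j).1]
      ring
    · rw [hu.lor_eq k j hkj]
      ring
  rw [lor_sum_left, Finset.sum_congr rfl fun k _ => h k, Finset.sum_sub_distrib]
  by_cases hji : j = i <;>
  simp [hji]

theorem exists_mem_face (hu : IsNormalized u) (hn : 2 ≤ n) {i j₁ j₂ : Fin (n + 1)}
    (h1 : j₁ ≠ i) (h2 : j₂ ≠ i) (h12 : j₁ ≠ j₂) {t ε : ℝ} (ht : 0 < t)
    (hε : t ^ 2 * ((n : ℝ) - 1) / n = 1 + 2 * ε ^ 2) :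
    ∃ x : Hyp n, x ∈ horo (u i) t ∩ oppositeHyperplane u i ∧
      lor x.1 (u j₁) = ε - t * ((n : ℝ) - 1) / n := by
  have hn0 : (2 : ℝ) ≤ n := by exact_mod_cast hn
  set w := ∑ k ∈ Finset.univ.erase i, u k with hw
  -- The first summand points to the centre of the face and has product -t with `u i`. The second is
  -- orthogonal to it and to `u i` and adds 2ε² to the square, which puts `v` on the hyperboloid.
  -- The two signs of ε give two points; ε = 0 gives the tangency point.
  set v := (t / n) • w + ε • (u j₁ + (-1 : ℝ) • u j₂) with hv
  have hg : ∀ k, lor v (u k) = (t / n) * ((if k = i then 0 else 1) - n) +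
      ε * (lor (u j₁) (u k) + -1 * lor (u j₂) (u k)) := by
    intro k
    rw [hv, lor_add_left, lor_smul_left, lor_smul_left, lor_add_left, lor_smul_left,
      hw, hu.lor_face_center]
  have hvi : lor v (u i) = -t := by
    rw [hg, hu.lor_eq j₁ i h1, hu.lor_eq j₂ i h2]
    simp
    field_simp
  have hv1 : lor v (u j₁) = ε - t * ((n : ℝ) - 1) / n := by
    rw [hg, (hu.ideal j₁).1, hu.lor_eq j₂ j₁ h12.symm, if_neg h1]
    ring
  have hv2 : lor v (u j₂) = -ε - t * ((n : ℝ) - 1) / n := by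
    rw [hg, (hu.ideal j₂).1, hu.lor_eq j₁ j₂ h12, if_neg h2]
    ring
  have hww : lor w w = n * (1 - n) := by
    have h : ∀ k ∈ Finset.univ.erase i, lor (u k) w = 1 - n := fun k hk => by
      rw [lor_comm, hw, hu.lor_face_center, if_neg (Finset.ne_of_mem_erase hk)]
    nth_rewrite 1 [hw]
    rw [lor_sum_left, Finset.sum_congr rfl h, Finset.sum_const,
      Finset.card_erase_of_mem (Finset.mem_univ i), Finset.card_univ, Fintype.card_fin,
      nsmul_eq_mul, Nat.add_sub_cancel]
  have hwv : lor w v = t * (1 - n) := by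
    rw [lor_comm, hv, lor_add_left, lor_smul_left, lor_smul_left, lor_add_left, lor_smul_left,
      hww, lor_comm (u j₁), lor_comm (u j₂), hw, hu.lor_face_center, hu.lor_face_center,
      if_neg h1, if_neg h2]
    field_simp
    ring
  have hvv : lor v v = -1 := by
    have h : lor v v = t / n * lor w v + ε * (lor v (u j₁) + -1 * lor v (u j₂)) := by
      conv_lhs => rw [hv, lor_add_left, lor_smul_left, lor_smul_left, lor_add_left, lor_smul_left]
      rw [← hv, lor_comm (u j₁), lor_comm (u j₂)]
    rw [h, hwv, hv1, hv2]
    have : t / n * (t * (1 - n)) = -(t ^ 2 * ((n : ℝ) - 1) / n) := by ring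
    rw [this, hε]
    ring
  refine ⟨⟨v, hvv, pos_of_lor_neg hvv (hu.ideal i) (by rw [hvi]; linarith)⟩, ⟨?_, ?_⟩, hv1⟩
  · change -(lor v (u i)) ≤ t
    rw [hvi, neg_neg]
  · have hmem : ∀ k, k ≠ i → u k ∈ Submodule.span ℝ (u '' {j | j ≠ i}) := fun k hk =>
      Submodule.subset_span ⟨k, hk, rfl⟩
    change v ∈ Submodule.span ℝ (u '' {j | j ≠ i})
    refine Submodule.add_mem _ (Submodule.smul_mem _ _ (Submodule.sum_mem _ fun k hk =>
      hmem k (Finset.ne_of_mem_erase hk))) (Submodule.smul_mem _ _ (Submodule.add_mem _ (hmem _ h1)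
        (Submodule.smul_mem _ _ (hmem _ h2))))

theorem exists_pair_mem_face (hu : IsNormalized u) (hn : 2 ≤ n) (i : Fin (n + 1)) {t : ℝ}
    (ht : 0 < t) (h : (n : ℝ) < t ^ 2 * ((n : ℝ) - 1)) :
    ∃ x y : Hyp n, x ≠ y ∧ x ∈ horo (u i) t ∩ oppositeHyperplane u i ∧
      y ∈ horo (u i) t ∩ oppositeHyperplane u i := by
  have hn0 : (2 : ℝ) ≤ n := by exact_mod_cast hn
  obtain ⟨j₁, j₂, h1, h2, h12⟩ := exists_ne_ne hn i
  have hpos : 0 < (t ^ 2 * ((n : ℝ) - 1) / n - 1) / 2 := by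
    have : 1 < t ^ 2 * ((n : ℝ) - 1) / n := by
      rw [lt_div_iff₀ (by linarith)]
      linarith
    linarith
  set ε := √((t ^ 2 * ((n : ℝ) - 1) / n - 1) / 2) with hε
  have hε0 : 0 < ε := Real.sqrt_pos.2 hpos
  have hε2 : t ^ 2 * ((n : ℝ) - 1) / n = 1 + 2 * ε ^ 2 := by
    rw [hε, Real.sq_sqrt hpos.le]
    ring
  obtain ⟨x, hx, hx1⟩ := hu.exists_mem_face hn h1 h2 h12 ht hε2
  obtain ⟨y, hy, hy1⟩ := hu.exists_mem_face hn h1 h2 h12 (ε := -ε) ht (by rw [hε2]; ring)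
  refine ⟨x, y, ?_, hx, hy⟩
  rintro rfl
  rw [hx1] at hy1
  linarith

theorem touch_face_iff (hu : IsNormalized u) (hn : 2 ≤ n) (i : Fin (n + 1)) {t : ℝ}
    (ht : 0 < t) :
    Touch (horo (u i) t) (oppositeHyperplane u i) ↔ t ^ 2 * ((n : ℝ) - 1) = n := by
  constructor
  · rintro ⟨p, hp⟩
    have hmem : p ∈ horo (u i) t ∩ oppositeHyperplane u i := by
      rw [hp]
      rfl
    by_contra hne
    rcases lt_or_gt_of_ne hne with h | h
    · exact hne (hu.eq_of_mem_face hn h.le hmem.1 hmem.2).1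
    · obtain ⟨x, y, hxy, hx, hy⟩ := hu.exists_pair_mem_face hn i ht h
      rw [hp, Set.mem_singleton_iff] at hx hy
      exact hxy (hx.trans hy.symm)
  · intro h
    have hn0 : (2 : ℝ) ≤ n := by exact_mod_cast hn
    obtain ⟨j₁, j₂, h1, h2, h12⟩ := exists_ne_ne hn i
    obtain ⟨x, hx, -⟩ := hu.exists_mem_face hn h1 h2 h12 (ε := 0) ht (by
      rw [h, div_self (by linarith)]
      ring)
    refine ⟨x, Set.eq_singleton_iff_unique_mem.2 ⟨hx, fun y hy => Subtype.ext ?_⟩⟩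
    rw [(hu.eq_of_mem_face hn h.le hx.1 hx.2).2, (hu.eq_of_mem_face hn h.le hy.1 hy.2).2]

theorem encard_face_le_one_iff (hu : IsNormalized u) (hn : 2 ≤ n) (i : Fin (n + 1)) {t : ℝ}
    (ht : 0 < t) :
    (horo (u i) t ∩ oppositeHyperplane u i).encard ≤ 1 ↔ t ^ 2 * ((n : ℝ) - 1) ≤ n := by
  rw [Set.encard_le_one_iff]
  constructor
  · intro h
    by_contra! hc
    obtain ⟨x, y, hxy, hx, hy⟩ := hu.exists_pair_mem_face hn i ht hc
    exact hxy (h x y hx hy)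
  · intro h x y hx hy
    refine Subtype.ext ?_
    rw [(hu.eq_of_mem_face hn h hx.1 hx.2).2, (hu.eq_of_mem_face hn h hy.1 hy.2).2]

end IsNormalized

/-! ### Volumes in barycentric coordinates -/

open MeasureTheory

/-- The quadratic form `-⟨x, x⟩` in barycentric coordinates with respect to a normalized
simplex. -/
def coordForm {m : ℕ} (a : Fin m → ℝ) : ℝ := (∑ i, a i) ^ 2 - ∑ i, a i ^ 2

theorem continuous_coordForm {m : ℕ} : Continuous (coordForm (m := m)) := by
  unfold coordForm
  fun_prop

theorem coordForm_nonneg {m : ℕ} {a : Fin m → ℝ} (ha : ∀ i, 0 ≤ a i) : 0 ≤ coordForm a :=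
  sub_nonneg.2 (Finset.sum_sq_le_sq_sum_of_nonneg fun i _ => ha i)

theorem mul_coordForm_le {m : ℕ} (a : Fin m → ℝ) :
    m * coordForm a ≤ ((m : ℝ) - 1) * (∑ i, a i) ^ 2 := by
  have h := sq_sum_le_card_mul_sum_sq (s := Finset.univ) (f := a)
  rw [Finset.card_univ, Fintype.card_fin] at h
  unfold coordForm
  nlinarith

theorem coordForm_succAbove {n : ℕ} (i : Fin (n + 1)) (a : Fin (n + 1) → ℝ) :
    coordForm a = 2 * a i * (∑ k, a (i.succAbove k)) + coordForm fun k => a (i.succAbove k) := by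
  unfold coordForm
  rw [Fin.sum_univ_succAbove _ i, Fin.sum_univ_succAbove (fun k => a k ^ 2) i]
  ring

/-- The region of the coordinate cone over the part of a horoball at the vertex `i` that lies on
the inner side of the faces through that vertex. -/
def slab {n : ℕ} (i : Fin (n + 1)) (t : ℝ) : Set (Fin (n + 1) → ℝ) :=
  {a | ((∀ k, 0 ≤ a (i.succAbove k)) ∧ 0 < ∑ k, a (i.succAbove k)) ∧
    (∑ k, a (i.succAbove k)) ^ 2 ≤ t ^ 2 * coordForm a ∧ coordForm a ≤ 1}

/-- The density of a unit horoball projected from its centre. -/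
noncomputable def profile {n : ℕ} (y : Fin n → ℝ) : ℝ≥0∞ :=
  open Classical in
  if (∀ k, 0 ≤ y k) ∧ 0 < ∑ k, y k then
    ENNReal.ofReal ((1 - (∑ k, y k) ^ 2) / (2 * ∑ k, y k)) else 0

theorem measurableSet_orthant {n : ℕ} :
    MeasurableSet {y : Fin n → ℝ | (∀ k, 0 ≤ y k) ∧ 0 < ∑ k, y k} := by
  have h : {y : Fin n → ℝ | (∀ k, 0 ≤ y k) ∧ 0 < ∑ k, y k} =
      (⋂ k, {y | 0 ≤ y k}) ∩ {y | 0 < ∑ k, y k} := by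
    ext
    simp
  rw [h]
  refine MeasurableSet.inter (MeasurableSet.iInter fun k => ?_) ?_
  · exact measurableSet_le measurable_const (measurable_pi_apply k)
  · exact measurableSet_lt measurable_const
      (Finset.measurable_sum _ fun k _ => measurable_pi_apply k)

theorem measurable_profile {n : ℕ} : Measurable (profile (n := n)) := by
  classical
  exact Measurable.ite measurableSet_orthant (by fun_prop) measurable_const

theorem volume_slice {n : ℕ} {t : ℝ} (ht : 0 < t) (y : Fin n → ℝ) :
    volume {z : ℝ | ((∀ k, 0 ≤ y k) ∧ 0 < ∑ k, y k) ∧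
      (∑ k, y k) ^ 2 ≤ t ^ 2 * (2 * z * (∑ k, y k) + coordForm y) ∧
        2 * z * (∑ k, y k) + coordForm y ≤ 1} =
      ENNReal.ofReal t⁻¹ * profile (t⁻¹ • y) := by
  have hsum : ∑ k, (t⁻¹ • y) k = t⁻¹ * ∑ k, y k := by
    simp [Finset.mul_sum]
  have ht' : 0 < t⁻¹ := inv_pos.2 ht
  have hcond : ((∀ k, 0 ≤ (t⁻¹ • y) k) ∧ 0 < ∑ k, (t⁻¹ • y) k) ↔
      ((∀ k, 0 ≤ y k) ∧ 0 < ∑ k, y k) := by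
    rw [hsum]
    simp [mul_nonneg_iff_of_pos_left ht', mul_pos_iff_of_pos_left ht']
  unfold profile
  by_cases h : (∀ k, 0 ≤ y k) ∧ 0 < ∑ k, y k
  · rw [if_pos (hcond.2 h), hsum]
    have hs := h.2
    set s := ∑ k, y k
    set c := coordForm y
    -- For fixed `y` both conditions are affine in `z`, the coordinate at the horoball's vertex. The
    -- interval has length (1 - s²/t²)/(2s), in which `coordForm y` has cancelled; this makes the
    -- scaling in t exact.
    have : {z : ℝ | ((∀ k, 0 ≤ y k) ∧ 0 < s) ∧
        s ^ 2 ≤ t ^ 2 * (2 * z * s + c) ∧ 2 * z * s + c ≤ 1} =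
        Set.Icc ((s ^ 2 / t ^ 2 - c) / (2 * s)) ((1 - c) / (2 * s)) := by
      ext z
      rw [Set.mem_ofPred_eq, and_iff_right h, Set.mem_Icc, div_le_iff₀ (by positivity),
        le_div_iff₀ (by positivity), sub_le_iff_le_add, div_le_iff₀ (by positivity),
        le_sub_iff_add_le]
      have e : z * (2 * s) = 2 * z * s := by ring
      rw [e, mul_comm (t ^ 2)]
    rw [this, Real.volume_Icc, ← ENNReal.ofReal_mul ht'.le]
    congr 1
    field_simp
    ring
  · rw [if_neg (fun h' => h (hcond.1 h')), mul_zero]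
    have : {z : ℝ | ((∀ k, 0 ≤ y k) ∧ 0 < ∑ k, y k) ∧
        (∑ k, y k) ^ 2 ≤ t ^ 2 * (2 * z * (∑ k, y k) + coordForm y) ∧
          2 * z * (∑ k, y k) + coordForm y ≤ 1} = ∅ := by
      ext z
      simp only [Set.mem_ofPred_eq, Set.mem_empty_iff_false, iff_false]
      exact fun h' => h h'.1
    rw [this, measure_empty]

theorem lintegral_comp_inv_smul {n : ℕ} {f : (Fin n → ℝ) → ℝ≥0∞} (hf : Measurable f) {t : ℝ}
    (ht : 0 < t) : ∫⁻ y, f (t⁻¹ • y) = ENNReal.ofReal (t ^ n) * ∫⁻ y, f y := by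
  have h := lintegral_map (μ := (volume : Measure (Fin n → ℝ))) hf
    (measurable_const_smul (t⁻¹ : ℝ))
  rw [Measure.map_addHaar_smul _ (inv_ne_zero ht.ne'), lintegral_smul_measure] at h
  rw [← h, Module.finrank_fin_fun, inv_pow, inv_inv, abs_of_pos (pow_pos ht n), smul_eq_mul]

/-- Fubini over the coordinate at vertex i: the slices contribute a factor 1/t, and rescaling the
other n coordinates contributes t^n. -/
theorem volume_slab {n : ℕ} (hn : 1 ≤ n) (i : Fin (n + 1)) {t : ℝ} (ht : 0 < t) :
    volume (slab i t) = ENNReal.ofReal (t ^ (n - 1)) * ∫⁻ y : Fin n → ℝ, profile y := by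
  set W : Set (ℝ × (Fin n → ℝ)) := {p | ((∀ k, 0 ≤ p.2 k) ∧ 0 < ∑ k, p.2 k) ∧
      (∑ k, p.2 k) ^ 2 ≤ t ^ 2 * (2 * p.1 * (∑ k, p.2 k) + coordForm p.2) ∧
        2 * p.1 * (∑ k, p.2 k) + coordForm p.2 ≤ 1} with hW
  have hcf : Measurable (coordForm (m := n)) := continuous_coordForm.measurable
  have hWm : MeasurableSet W := by
    have h : W = (Prod.snd ⁻¹' {y : Fin n → ℝ | (∀ k, 0 ≤ y k) ∧ 0 < ∑ k, y k}) ∩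
        ({p | (∑ k, p.2 k) ^ 2 ≤ t ^ 2 * (2 * p.1 * (∑ k, p.2 k) + coordForm p.2)} ∩
          {p | 2 * p.1 * (∑ k, p.2 k) + coordForm p.2 ≤ 1}) := rfl
    have hf : Measurable fun p : ℝ × (Fin n → ℝ) =>
        2 * p.1 * (∑ k, p.2 k) + coordForm p.2 := by fun_prop
    rw [h]
    exact (measurable_snd measurableSet_orthant).inter
      ((measurableSet_le (by fun_prop) (hf.const_mul _)).inter
        (measurableSet_le hf measurable_const))
  have hpre : slab i t = MeasurableEquiv.piFinSuccAbove (fun _ => ℝ) i ⁻¹' W := by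
    ext a
    simp only [slab, hW, Set.mem_ofPred_eq, Set.mem_preimage, coordForm_succAbove i a]
    rfl
  rw [hpre, (volume_preserving_piFinSuccAbove (fun _ : Fin (n + 1) => ℝ) i).measure_preimage_equiv,
    Measure.volume_eq_prod, Measure.prod_apply_symm hWm]
  have hslice : ∀ y : Fin n → ℝ, volume ((fun z => (z, y)) ⁻¹' W) =
      ENNReal.ofReal t⁻¹ * profile (t⁻¹ • y) := fun y => volume_slice ht y
  simp only [hslice]
  rw [lintegral_const_mul _
      (show Measurable fun y : Fin n → ℝ => profile (t⁻¹ • y) from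
        measurable_profile.comp (measurable_const_smul _)),
    lintegral_comp_inv_smul measurable_profile ht, ← mul_assoc,
    ← ENNReal.ofReal_mul (inv_pos.2 ht).le]
  congr 2
  obtain ⟨m, rfl⟩ : ∃ m, n = m + 1 := ⟨n - 1, by omega⟩
  rw [Nat.add_sub_cancel, pow_succ]
  field_simp

theorem lintegral_profile_pos {n : ℕ} (hn : 1 ≤ n) : 0 < ∫⁻ y : Fin n → ℝ, profile y := by
  rw [lintegral_pos_iff_support measurable_profile]
  have hopen : IsOpen {y : Fin n → ℝ | (∀ k, 0 < y k) ∧ ∑ k, y k < 1} := by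
    have h : {y : Fin n → ℝ | (∀ k, 0 < y k) ∧ ∑ k, y k < 1} =
        (⋂ k, {y | 0 < y k}) ∩ {y | ∑ k, y k < 1} := by
      ext
      simp
    rw [h]
    refine (isOpen_iInter_of_finite fun k => ?_).inter ?_
    · exact isOpen_lt continuous_const (continuous_apply k)
    · exact isOpen_lt (continuous_finsetSum _ fun k _ => continuous_apply k) continuous_const
  have hne : {y : Fin n → ℝ | (∀ k, 0 < y k) ∧ ∑ k, y k < 1}.Nonempty := by
    refine ⟨fun _ => 1 / (n + 1), fun k => by positivity, ?_⟩
    rw [Finset.sum_const, Finset.card_univ, Fintype.card_fin, nsmul_eq_mul, mul_one_div,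
      div_lt_one (by positivity)]
    linarith
  refine (hopen.measure_pos volume hne).trans_le (measure_mono fun y hy => ?_)
  have : NeZero n := ⟨by omega⟩
  have hs : 0 < ∑ k, y k := Finset.sum_pos (fun k _ => hy.1 k) Finset.univ_nonempty
  rw [Function.mem_support]
  unfold profile
  rw [if_pos ⟨fun k => (hy.1 k).le, hs⟩]
  refine (ENNReal.ofReal_pos.2 (div_pos ?_ (by positivity))).ne'
  have := hy.2
  nlinarith

theorem lintegral_profile_lt_top {n : ℕ} (hn : 2 ≤ n) : ∫⁻ y : Fin n → ℝ, profile y < ⊤ := by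
  have hn0 : (2 : ℝ) ≤ n := by exact_mod_cast hn
  -- The profile is at most 1/s and vanishes for s > 1. Since each y_k ≤ s, 1/s is at most the
  -- product of the y_k^(-1/n), whose factors are integrable on (0, 1] because n ≥ 2.
  set h : ℝ → ℝ := Set.indicator (Set.Ioc 0 1) fun x => x ^ (-(1 / (n : ℝ))) with hh
  have hint : Integrable h := by
    rw [hh, integrable_indicator_iff measurableSet_Ioc]
    have := intervalIntegral.intervalIntegrable_rpow' (a := 0) (b := 1) (r := -(1 / (n : ℝ))) (by
      rw [neg_lt_neg_iff, div_lt_one (by linarith)]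
      linarith)
    rwa [intervalIntegrable_iff_integrableOn_Ioc_of_le zero_le_one] at this
  have hprod : Integrable (fun y : Fin n → ℝ => ∏ k, h (y k)) :=
    Integrable.fintype_prod (f := fun _ => h) fun _ => hint
  have hae : ∀ᵐ y : Fin n → ℝ, ∀ k, y k ≠ 0 := by
    rw [ae_all_iff]
    exact fun k => Measure.ae_eval_ne _ k 0
  refine lt_of_le_of_lt (lintegral_mono_ae ?_) hprod.lintegral_lt_top
  filter_upwards [hae] with y hy
  unfold profile
  split_ifs with hc
  · refine ENNReal.ofReal_le_ofReal ?_
    set s := ∑ k, y k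
    have hle : ∀ k, y k ≤ s := fun k =>
      Finset.single_le_sum (f := y) (fun j _ => hc.1 j) (Finset.mem_univ k)
    have hpos : ∀ k, 0 < y k := fun k => lt_of_le_of_ne (hc.1 k) (hy k).symm
    have hh0 : ∀ x, 0 ≤ h x := fun x => Set.indicator_nonneg (fun z hz =>
      Real.rpow_nonneg hz.1.le _) x
    by_cases hs1 : s ≤ 1
    · have h1 : ∀ k, h (y k) = (y k) ^ (-(1 / (n : ℝ))) := fun k =>
        Set.indicator_of_mem (Set.mem_Ioc.2 ⟨hpos k, (hle k).trans hs1⟩) _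
      calc (1 - s ^ 2) / (2 * s) ≤ s⁻¹ := by
            have h2 : s⁻¹ * (2 * s) = 2 := by
              rw [mul_comm, mul_assoc, mul_inv_cancel₀ hc.2.ne', mul_one]
            rw [div_le_iff₀ (by linarith [hc.2]), h2]
            linarith [sq_nonneg s]
        _ = ∏ _k : Fin n, s ^ (-(1 / (n : ℝ))) := by
            rw [Finset.prod_const, Finset.card_univ, Fintype.card_fin, ← Real.rpow_natCast,
              ← Real.rpow_mul hc.2.le, neg_mul, one_div, inv_mul_cancel₀ (by linarith),
              Real.rpow_neg_one]
        _ ≤ ∏ k, h (y k) := by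
            refine Finset.prod_le_prod (fun k _ => Real.rpow_nonneg hc.2.le _) fun k _ => ?_
            rw [h1]
            exact Real.rpow_le_rpow_of_nonpos (hpos k) (hle k) (by
              rw [neg_nonpos]
              positivity)
    · refine le_trans (div_nonpos_of_nonpos_of_nonneg ?_ ?_) (Finset.prod_nonneg fun k _ => hh0 _)
      · nlinarith
      · linarith [hc.2]
  · exact zero_le

/-- The cone over the simplex, in coordinates, cut off at the hyperboloid. -/
def coordCone (n : ℕ) : Set (Fin (n + 1) → ℝ) :=
  {a | (∀ i, 0 ≤ a i) ∧ 0 < coordForm a ∧ coordForm a ≤ 1}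

theorem sum_eq_add_succAbove {n : ℕ} (i : Fin (n + 1)) (a : Fin (n + 1) → ℝ) :
    ∑ k, a k - a i = ∑ k, a (i.succAbove k) := by
  rw [Fin.sum_univ_succAbove _ i]
  ring

theorem sum_succAbove_pos {n : ℕ} (i : Fin (n + 1)) {a : Fin (n + 1) → ℝ} (ha : ∀ i, 0 ≤ a i)
    (hq : 0 < coordForm a) : 0 < ∑ k, a (i.succAbove k) := by
  have h0 : 0 ≤ ∑ k, a (i.succAbove k) := Finset.sum_nonneg fun k _ => ha _
  refine lt_of_le_of_ne h0 fun h => ?_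
  rw [coordForm_succAbove i, coordForm, ← h] at hq
  have : 0 ≤ ∑ k, a (i.succAbove k) ^ 2 := Finset.sum_nonneg fun k _ => sq_nonneg _
  linarith

/-- The bound on t says that the horoball does not cross the opposite face, so the constraint a_i ≥
0 is automatic: with a_i < 0 the form would drop below its value on the other coordinates, which is
at most (n-1)/n times the square of their sum. -/
theorem coordCone_inter_eq_slab {n : ℕ} (hn : 2 ≤ n) (i : Fin (n + 1)) {t : ℝ} (ht : 0 < t)
    (ht' : t ^ 2 * ((n : ℝ) - 1) ≤ n) :
    {a | a ∈ coordCone n ∧ (∑ k, a k - a i) ^ 2 ≤ t ^ 2 * coordForm a} = slab i t := by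
  have hn0 : (2 : ℝ) ≤ n := by exact_mod_cast hn
  ext a
  rw [Set.mem_ofPred_eq, sum_eq_add_succAbove]
  constructor
  · rintro ⟨⟨ha, hq0, hq1⟩, h⟩
    exact ⟨⟨fun k => ha _, sum_succAbove_pos i ha hq0⟩, h, hq1⟩
  · rintro ⟨⟨ha, hs⟩, h, hq1⟩
    have hai : 0 ≤ a i := by
      by_contra! hc
      rw [coordForm_succAbove i] at h
      have hm := mul_coordForm_le fun k => a (i.succAbove k)
      set s := ∑ k, a (i.succAbove k)
      set c := coordForm fun k => a (i.succAbove k)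
      have h1 : t ^ 2 * (n * c) ≤ n * s ^ 2 :=
        calc t ^ 2 * (n * c) ≤ t ^ 2 * (((n : ℝ) - 1) * s ^ 2) :=
              mul_le_mul_of_nonneg_left hm (by positivity)
          _ = (t ^ 2 * ((n : ℝ) - 1)) * s ^ 2 := by ring
          _ ≤ n * s ^ 2 := mul_le_mul_of_nonneg_right ht' (by positivity)
      have h2 : t ^ 2 * c ≤ s ^ 2 := by
        have : (n : ℝ) * (t ^ 2 * c) ≤ n * s ^ 2 := by linarith
        exact le_of_mul_le_mul_left this (by linarith)
      have h3 : 0 < t ^ 2 * (2 * -a i * s) := by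
        have : 0 < -a i := by linarith
        positivity
      linarith
    refine ⟨⟨fun k => ?_, ?_, hq1⟩, h⟩
    · rcases eq_or_ne k i with rfl | hk
      · exact hai
      · obtain ⟨l, rfl⟩ := Fin.exists_succAbove_eq hk
        exact ha l
    · have : 0 < t ^ 2 * coordForm a := lt_of_lt_of_le (by positivity) h
      exact (mul_pos_iff_of_pos_left (by positivity)).1 this

/-- Every point lies in a sufficiently large horoball at the vertex of its largest coordinate. This
yields finite volume; these slabs may extend beyond the simplex. -/
theorem coordCone_subset {n : ℕ} : coordCone n ⊆ ⋃ i, slab i (√(n + 1)) := by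
  rintro a ⟨ha, hq0, hq1⟩
  obtain ⟨i, -, hi⟩ := Finset.exists_max_image Finset.univ a Finset.univ_nonempty
  refine Set.mem_iUnion.2 ⟨i, ⟨fun k => ha _, sum_succAbove_pos i ha hq0⟩, ?_, hq1⟩
  rw [Real.sq_sqrt (by positivity)]
  have h1 : ∑ k, a (i.succAbove k) ≤ n * a i := by
    calc ∑ k, a (i.succAbove k) ≤ ∑ _k : Fin n, a i :=
          Finset.sum_le_sum fun k _ => hi _ (Finset.mem_univ _)
      _ = n * a i := by simp
  have h2 := coordForm_nonneg (a := fun k => a (i.succAbove k)) fun k => ha _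
  have h3 := sum_succAbove_pos i ha hq0
  rw [coordForm_succAbove i]
  set s := ∑ k, a (i.succAbove k)
  have h4 : s ^ 2 ≤ n * a i * s := by
    rw [pow_two]
    exact mul_le_mul_of_nonneg_right h1 h3.le
  have h5 : 0 ≤ a i * s := mul_nonneg (ha i) h3.le
  have h6 : 0 ≤ (n : ℝ) * (a i * s) := by positivity
  have h7 : 0 ≤ ((n : ℝ) + 1) * coordForm fun k => a (i.succAbove k) := by positivity
  linarith

theorem volume_coordCone_lt_top {n : ℕ} (hn : 2 ≤ n) : volume (coordCone n) < ⊤ := by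
  refine (measure_mono coordCone_subset).trans_lt ((measure_iUnion_le _).trans_lt ?_)
  rw [tsum_fintype]
  refine ENNReal.sum_lt_top.2 fun i _ => ?_
  rw [volume_slab (by omega) i (Real.sqrt_pos.2 (by positivity))]
  exact ENNReal.mul_lt_top ENNReal.ofReal_lt_top (lintegral_profile_lt_top hn)

theorem volume_coordCone_pos {n : ℕ} (hn : 2 ≤ n) : 0 < volume (coordCone n) := by
  have hn0 : (2 : ℝ) ≤ n := by exact_mod_cast hn
  have h := volume_slab (n := n) (by omega) 0 one_pos
  rw [← coordCone_inter_eq_slab hn 0 one_pos (by linarith), one_pow (n - 1),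
    ENNReal.ofReal_one, one_mul] at h
  exact ((lintegral_profile_pos (by omega)).trans_eq h.symm).trans_le
    (measure_mono fun a ha => ha.1)

/-- The factor relating hyperbolic volume to volume in barycentric coordinates. -/
noncomputable def volFactor {n : ℕ} (u : Fin (n + 1) → LVec n) : ℝ≥0∞ :=
  (n + 1) * ENNReal.ofReal |LinearMap.det (Fintype.linearCombination ℝ u)|

theorem volFactor_lt_top {n : ℕ} (u : Fin (n + 1) → LVec n) : volFactor u < ⊤ :=
  ENNReal.mul_lt_top (by finiteness) ENNReal.ofReal_lt_top

namespace IsNormalized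

variable {n : ℕ} {u : Fin (n + 1) → LVec n}

/-- Hyperbolic volume is defined through cones, so a scale-invariant condition carries over directly
to the linear coordinates, where only a determinant intervenes. -/
theorem cone_eq_image (hu : IsNormalized u) (P : LVec n → Prop)
    (hP : ∀ r : ℝ, 0 < r → ∀ v, P (r • v) ↔ P v) :
    {v : LVec n | ∃ x ∈ {x : Hyp n | x ∈ simplex u ∧ P x.1}, ∃ r : ℝ, 0 < r ∧ r ≤ 1 ∧
      v = r • x.1} =
      Fintype.linearCombination ℝ u '' {a | a ∈ coordCone n ∧ P (∑ i, a i • u i)} := by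
  have hself : ∀ a : Fin (n + 1) → ℝ,
      lor (∑ i, a i • u i) (∑ i, a i • u i) = -coordForm a := fun a => by
    rw [lor_sum_smul_self hu, coordForm]
    ring
  ext v
  simp only [Set.mem_ofPred_eq, Set.mem_image, Fintype.linearCombination_apply]
  constructor
  · rintro ⟨x, ⟨⟨a, ha, hax⟩, hPx⟩, r, hr, hr1, rfl⟩
    have hra : ∑ i, (r • a) i • u i = r • x.1 := by
      rw [hax, Finset.smul_sum]
      exact Finset.sum_congr rfl fun i _ => by rw [Pi.smul_apply, smul_assoc]
    have hq : coordForm (r • a) = r ^ 2 := by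
      have h := hself (r • a)
      rw [hra, lor_smul_left, lor_smul_right, x.2.1] at h
      linarith
    refine ⟨r • a, ⟨⟨fun i => mul_nonneg hr.le (ha i), ?_, ?_⟩, ?_⟩, hra⟩
    · rw [hq]
      positivity
    · rw [hq]
      exact pow_le_one₀ hr.le hr1
    · rwa [hra, hP r hr]
  · rintro ⟨a, ⟨⟨ha, hq0, hq1⟩, hPa⟩, rfl⟩
    set r := √(coordForm a) with hr
    have hr0 : 0 < r := Real.sqrt_pos.2 hq0
    have hr2 : r * r = coordForm a := Real.mul_self_sqrt hq0.le
    have hvv : lor (r⁻¹ • ∑ i, a i • u i) (r⁻¹ • ∑ i, a i • u i) = -1 := by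
      rw [lor_smul_left, lor_smul_right, hself, ← hr2]
      field_simp
    have hneg : lor (r⁻¹ • ∑ i, a i • u i) (u 0) < 0 := by
      have h := sum_succAbove_pos 0 ha hq0
      rw [← sum_eq_add_succAbove] at h
      rw [lor_smul_left, lor_sum_smul_left hu]
      exact mul_neg_of_pos_of_neg (inv_pos.2 hr0) (by linarith)
    refine ⟨⟨r⁻¹ • ∑ i, a i • u i, hvv, pos_of_lor_neg hvv (hu.ideal 0) hneg⟩, ⟨⟨r⁻¹ • a, ?_, ?_⟩,
      ?_⟩, r, hr0, Real.sqrt_le_one.2 hq1, ?_⟩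
    · exact fun i => mul_nonneg (inv_pos.2 hr0).le (ha i)
    · change r⁻¹ • ∑ i, a i • u i = _
      rw [Finset.smul_sum]
      exact Finset.sum_congr rfl fun i _ => by rw [Pi.smul_apply, smul_assoc]
    · exact (hP _ (inv_pos.2 hr0) _).2 hPa
    · change _ = r • r⁻¹ • ∑ i, a i • u i
      rw [smul_smul, mul_inv_cancel₀ hr0.ne', one_smul]

theorem hypVol_eq (hu : IsNormalized u) (P : LVec n → Prop)
    (hP : ∀ r : ℝ, 0 < r → ∀ v, P (r • v) ↔ P v) :
    hypVol {x : Hyp n | x ∈ simplex u ∧ P x.1} =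
      (n + 1) * (ENNReal.ofReal |LinearMap.det (Fintype.linearCombination ℝ u)| *
        volume {a | a ∈ coordCone n ∧ P (∑ i, a i • u i)}) := by
  rw [hypVol, hu.cone_eq_image P hP, Measure.addHaar_image_linearMap]

theorem volFactor_pos (hu : IsNormalized u) : 0 < volFactor u := by
  have hdet : LinearMap.det (Fintype.linearCombination ℝ u) ≠ 0 := by
    have h := (LinearEquiv.ofInjectiveEndo _ hu.injective_linearCombination).isUnit_det'
    exact h.ne_zero
  exact ENNReal.mul_pos (by simp) (ENNReal.ofReal_pos.2 (abs_pos.2 hdet)).ne'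

theorem hypVol_simplex (hu : IsNormalized u) :
    hypVol (simplex u) = volFactor u * volume (coordCone n) := by
  have h := hu.hypVol_eq (fun _ => True) (fun _ _ _ => Iff.rfl)
  simp only [and_true] at h
  rw [volFactor, mul_assoc]
  exact h

theorem hypVol_horo_inter (hu : IsNormalized u) (hn : 2 ≤ n) (i : Fin (n + 1)) {t : ℝ}
    (ht : 0 < t) (ht' : t ^ 2 * ((n : ℝ) - 1) ≤ n) :
    hypVol (horo (u i) t ∩ simplex u) =
      volFactor u * (ENNReal.ofReal (t ^ (n - 1)) * ∫⁻ y : Fin n → ℝ, profile y) := by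
  -- The horoball condition, made homogeneous of degree two so that it is scale invariant.
  have h := hu.hypVol_eq (fun v => lor v (u i) ^ 2 ≤ t ^ 2 * -(lor v v)) (fun r hr v => by
    rw [lor_smul_left, lor_smul_left, lor_smul_right, mul_pow,
      show t ^ 2 * -(r * (r * lor v v)) = r ^ 2 * (t ^ 2 * -(lor v v)) by ring]
    exact mul_le_mul_iff_of_pos_left (by positivity))
  have h1 : {x : Hyp n | x ∈ simplex u ∧ lor x.1 (u i) ^ 2 ≤ t ^ 2 * -(lor x.1 x.1)} =
      horo (u i) t ∩ simplex u := by
    ext x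
    have hp := hu.neg_lor_pos i x
    rw [Set.mem_ofPred_eq, x.2.1, neg_neg, mul_one, ← neg_sq, Set.mem_inter_iff, and_comm,
      pow_le_pow_iff_left₀ hp.le ht.le two_ne_zero]
    rfl
  have h2 : {a | a ∈ coordCone n ∧ lor (∑ k, a k • u k) (u i) ^ 2 ≤
      t ^ 2 * -(lor (∑ k, a k • u k) (∑ k, a k • u k))} = slab i t := by
    rw [← coordCone_inter_eq_slab hn i ht ht']
    ext a
    rw [Set.mem_ofPred_eq, Set.mem_ofPred_eq, lor_sum_smul_left hu, lor_sum_smul_self hu, ← neg_sq,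
      neg_sub, neg_sub, coordForm]
  rw [h1, h2, volume_slab (by omega) i ht] at h
  rw [h, volFactor, mul_assoc]

end IsNormalized

/-- The ratio between the volume cut out of the simplex by a unit horoball at a vertex and the
volume of the simplex. -/
noncomputable def unitRatio (n : ℕ) : ℝ :=
  (∫⁻ y : Fin n → ℝ, profile y).toReal / (volume (coordCone n)).toReal

theorem unitRatio_pos {n : ℕ} (hn : 2 ≤ n) : 0 < unitRatio n :=
  div_pos (ENNReal.toReal_pos (lintegral_profile_pos (by omega)).ne' (lintegral_profile_lt_top hn).ne)
    (ENNReal.toReal_pos (volume_coordCone_pos hn).ne' (volume_coordCone_lt_top hn).ne)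

theorem IsNormalized.ratio_eq {n : ℕ} {u : Fin (n + 1) → LVec n} (hu : IsNormalized u)
    (hn : 2 ≤ n) (i : Fin (n + 1)) {t : ℝ} (ht : 0 < t) (ht' : t ^ 2 * ((n : ℝ) - 1) ≤ n) :
    (hypVol (horo (u i) t ∩ simplex u)).toReal / (hypVol (simplex u)).toReal =
      t ^ (n - 1) * unitRatio n := by
  have hD : (volFactor u).toReal ≠ 0 :=
    (ENNReal.toReal_pos hu.volFactor_pos.ne' (volFactor_lt_top u).ne).ne'
  rw [hu.hypVol_horo_inter hn i ht ht', hu.hypVol_simplex, ENNReal.toReal_mul, ENNReal.toReal_mul,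
    ENNReal.toReal_mul, ENNReal.toReal_ofReal (by positivity), mul_div_mul_left _ _ hD, unitRatio,
    mul_div_assoc]

/-! ### The extremal problem and the constant M -/

/-- The bound `M + n / M` for sums of `n + 1` positive numbers bounded by `M` with pairwise
products at most one, and the equality case. -/
theorem sum_le_of_pairwise_mul_le_one {n : ℕ} (hn : 2 ≤ n) {M : ℝ} (hM : (n : ℝ) ≤ M)
    {x : Fin (n + 1) → ℝ} (hx : ∀ i, 0 < x i) (hxx : ∀ i j, i ≠ j → x i * x j ≤ 1)
    (hxM : ∀ i, x i ≤ M) :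
    ∑ i, x i ≤ M + n / M ∧
      (∑ i, x i = M + n / M →
        (M = n ∧ ∀ i, x i = 1) ∨ ∃ k, x k = M ∧ ∀ i, i ≠ k → x i = 1 / M) := by
  have hn0 : (2 : ℝ) ≤ n := by exact_mod_cast hn
  have hM0 : 0 < M := by linarith
  obtain ⟨k, -, hk⟩ := Finset.exists_max_image Finset.univ x Finset.univ_nonempty
  have hk : ∀ i, x i ≤ x k := fun i => hk i (Finset.mem_univ i)
  rcases le_or_gt (x k) 1 with h1 | h1
  · have hle : ∀ i ∈ Finset.univ, x i ≤ 1 := fun i _ => (hk i).trans h1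
    have hsum : ∑ _i : Fin (n + 1), (1 : ℝ) = n + 1 := by simp
    have hS : ∑ i, x i ≤ n + 1 := hsum ▸ Finset.sum_le_sum hle
    have hid : M + n / M - (n + 1) = (M - 1) * (M - n) / M := by
      field_simp
      ring
    have hnn : 0 ≤ (M - 1) * (M - n) / M :=
      div_nonneg (mul_nonneg (by linarith) (by linarith)) hM0.le
    refine ⟨by linarith, fun heq => Or.inl ⟨?_, ?_⟩⟩
    · have h0 : (M - 1) * (M - n) / M = 0 := by linarith
      rcases div_eq_zero_iff.1 h0 with h | h
      · rcases mul_eq_zero.1 h with h | h <;> linarith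
      · linarith
    · have : ∑ i, x i = ∑ _i : Fin (n + 1), (1 : ℝ) := by linarith
      exact fun i => (Finset.sum_eq_sum_iff_of_le hle).1 this i (Finset.mem_univ i)
  · have hk0 := hx k
    have hle : ∀ i ∈ Finset.univ.erase k, x i ≤ 1 / x k := fun i hi => by
      rw [le_div_iff₀ hk0]
      exact hxx i k (Finset.ne_of_mem_erase hi)
    have hsum : ∑ _i ∈ Finset.univ.erase k, 1 / x k = n / x k := by
      rw [Finset.sum_const, Finset.card_erase_of_mem (Finset.mem_univ k), Finset.card_univ,
        Fintype.card_fin, nsmul_eq_mul, Nat.add_sub_cancel, mul_one_div]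
    have hS : ∑ i ∈ Finset.univ.erase k, x i ≤ n / x k := hsum ▸ Finset.sum_le_sum hle
    have hsplit : x k + ∑ i ∈ Finset.univ.erase k, x i = ∑ i, x i :=
      Finset.add_sum_erase _ _ (Finset.mem_univ k)
    -- The second factor is positive since M ≥ n and x_k > 1, so equality forces x_k = M.
    have hid : M + n / M - (x k + n / x k) = (M - x k) * (M * x k - n) / (M * x k) := by
      field_simp
      ring
    have hMx : 0 < M * x k - n := by nlinarith
    have hnn : 0 ≤ (M - x k) * (M * x k - n) / (M * x k) :=
      div_nonneg (mul_nonneg (sub_nonneg.2 (hxM k)) hMx.le) (by positivity)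
    refine ⟨by linarith, fun heq => Or.inr ⟨k, ?_⟩⟩
    have h0 : (M - x k) * (M * x k - n) / (M * x k) = 0 := by linarith
    have hkM : x k = M := by
      rcases div_eq_zero_iff.1 h0 with h | h
      · rcases mul_eq_zero.1 h with h | h <;> linarith
      · have : 0 < M * x k := by positivity
        linarith
    refine ⟨hkM, fun i hi => ?_⟩
    have : ∑ i ∈ Finset.univ.erase k, x i = ∑ _i ∈ Finset.univ.erase k, 1 / x k := by linarith
    rw [← hkM]
    exact (Finset.sum_eq_sum_iff_of_le hle).1 this i (Finset.mem_erase.2 ⟨hi, Finset.mem_univ i⟩)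

/-- The normalized size of the largest admissible horoball. -/
noncomputable def maxSize (n : ℕ) : ℝ := √(2 * n / (n - 1)) ^ (n - 1)

theorem log_maxSize {n : ℕ} (hn : 2 ≤ n) : Real.log (maxSize n) = ((n : ℝ) - 1) * q n := by
  rw [maxSize, Real.log_pow, Nat.cast_sub (by omega), Nat.cast_one, q]

theorem maxSize_pos {n : ℕ} (hn : 2 ≤ n) : 0 < maxSize n := by
  have hn0 : (2 : ℝ) ≤ n := by exact_mod_cast hn
  exact pow_pos (Real.sqrt_pos.2 (div_pos (by linarith) (by linarith))) _

theorem maxSize_eq {n : ℕ} (hn : n = 2 ∨ n = 3) : maxSize n = n := by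
  rcases hn with rfl | rfl
  · have h : (2 * ((2 : ℕ) : ℝ) / ((2 : ℕ) - 1)) = 2 ^ 2 := by norm_num
    rw [maxSize, h, Real.sqrt_sq (by norm_num)]
    norm_num
  · have h : (2 * ((3 : ℕ) : ℝ) / ((3 : ℕ) - 1)) = 3 := by norm_num
    rw [maxSize, h, Real.sq_sqrt (by norm_num)]
    norm_num

theorem sq_lt_two_pow {n : ℕ} (hn : 5 ≤ n) : n ^ 2 < 2 ^ n := by
  induction n, hn using Nat.le_induction with
  | base => norm_num
  | succ n hn ih =>
    rw [pow_succ 2]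
    nlinarith

theorem lt_maxSize {n : ℕ} (hn : 4 ≤ n) : (n : ℝ) < maxSize n := by
  have hn0 : (4 : ℝ) ≤ n := by exact_mod_cast hn
  refine lt_of_pow_lt_pow_left₀ 2 (maxSize_pos (by omega)).le ?_
  rw [maxSize, ← pow_mul, mul_comm (n - 1) 2, pow_mul, Real.sq_sqrt (div_nonneg (by linarith) (by linarith))]
  -- After squaring, Bernoulli gives the lower bound 2^n, which equals n² at n = 4; that case is
  -- therefore computed directly.
  rcases hn.eq_or_lt with rfl | h5
  · norm_num
  · have hb : (2 : ℝ) ≤ (1 + 1 / ((n : ℝ) - 1)) ^ (n - 1) := by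
      have h := one_add_mul_le_pow (a := 1 / ((n : ℝ) - 1))
        (by linarith [show 0 < 1 / ((n : ℝ) - 1) from one_div_pos.2 (by linarith)]) (n - 1)
      rw [Nat.cast_sub (by omega), Nat.cast_one, mul_one_div_cancel (by linarith)] at h
      linarith
    have h2 : (n : ℝ) ^ 2 < 2 ^ n := by exact_mod_cast sq_lt_two_pow h5
    have e : 2 * (n : ℝ) / (n - 1) = 2 * (1 + 1 / ((n : ℝ) - 1)) := by
      have : (n : ℝ) - 1 ≠ 0 := by linarith
      field_simp
      ring
    rw [e, mul_pow]
    calc (n : ℝ) ^ 2 < 2 ^ n := h2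
      _ = 2 ^ (n - 1) * 2 := by rw [← pow_succ, Nat.sub_add_cancel (by omega)]
      _ ≤ _ := mul_le_mul_of_nonneg_left hb (by positivity)

theorem le_maxSize {n : ℕ} (hn : 2 ≤ n) : (n : ℝ) ≤ maxSize n := by
  by_cases h : n = 2 ∨ n = 3
  · exact (maxSize_eq h).ge
  · exact (lt_maxSize (by omega)).le

theorem q_eq {n : ℕ} (hn : n = 2 ∨ n = 3) : q n = 1 / ((n : ℝ) - 1) * Real.log n := by
  have hn2 : 2 ≤ n := by omega
  have hn0 : (2 : ℝ) ≤ n := by exact_mod_cast hn2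
  have h := log_maxSize hn2
  rw [maxSize_eq hn] at h
  rw [h, ← mul_assoc, one_div_mul_cancel (by linarith), one_mul]

theorem lt_q {n : ℕ} (hn : 4 ≤ n) : 1 / ((n : ℝ) - 1) * Real.log n < q n := by
  have hn0 : (4 : ℝ) ≤ n := by exact_mod_cast hn
  have h := Real.log_lt_log (by linarith) (lt_maxSize hn)
  rw [log_maxSize (by omega)] at h
  rw [one_div_mul_eq_div, div_lt_iff₀ (by linarith)]
  linarith

/-! ### Sizes of horoballs -/

/-- The size of the horoball with parameter `t`, proportional to the volume that it cuts out of
the simplex and equal to one for horoballs of the same type that touch each other. -/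
noncomputable def size (n : ℕ) (t : ℝ) : ℝ := (√2 * t) ^ (n - 1)

section size

variable {n : ℕ} {s t : ℝ}

theorem size_pos (ht : 0 < t) : 0 < size n t := by
  unfold size
  positivity

theorem size_eq_mul (n : ℕ) (t : ℝ) : size n t = √2 ^ (n - 1) * t ^ (n - 1) := mul_pow _ _ _

theorem size_mul_size (n : ℕ) (s t : ℝ) : size n s * size n t = (2 * (s * t)) ^ (n - 1) := by
  rw [size, size, ← mul_pow, mul_mul_mul_comm, Real.mul_self_sqrt zero_le_two]

theorem size_mul_le_one_iff (hn : 2 ≤ n) (hs : 0 < s) (ht : 0 < t) :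
    size n s * size n t ≤ 1 ↔ s * t ≤ 1 / 2 := by
  rw [size_mul_size, pow_le_one_iff_of_nonneg (by positivity) (by omega)]
  constructor <;> intro h <;> linarith

theorem size_mul_eq_one_iff (hn : 2 ≤ n) (hs : 0 < s) (ht : 0 < t) :
    size n s * size n t = 1 ↔ s * t = 1 / 2 := by
  rw [size_mul_size, pow_eq_one_iff_of_nonneg (by positivity) (by omega)]
  constructor <;> intro h <;> linarith

theorem size_inj (hn : 2 ≤ n) (hs : 0 < s) (ht : 0 < t) : size n s = size n t ↔ s = t := by
  rw [size, size, pow_left_inj₀ (by positivity) (by positivity) (by omega)]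
  simp

theorem exists_size_eq (hn : 2 ≤ n) {x : ℝ} (hx : 0 < x) : ∃ t : ℝ, 0 < t ∧ size n t = x := by
  refine ⟨x ^ (((n - 1 : ℕ) : ℝ)⁻¹) / √2, by positivity, ?_⟩
  rw [size, mul_div_cancel₀ _ (by positivity), Real.rpow_inv_natCast_pow hx.le (by omega)]

theorem two_mul_sq_eq (t : ℝ) : (√2 * t) ^ 2 = 2 * t ^ 2 := by
  rw [mul_pow, Real.sq_sqrt zero_le_two]

theorem size_le_maxSize_iff (hn : 2 ≤ n) (ht : 0 < t) :
    size n t ≤ maxSize n ↔ t ^ 2 * ((n : ℝ) - 1) ≤ n := by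
  have hn0 : (2 : ℝ) ≤ n := by exact_mod_cast hn
  rw [size, maxSize, pow_le_pow_iff_left₀ (by positivity) (by positivity) (by omega),
    Real.le_sqrt' (by positivity), two_mul_sq_eq, le_div_iff₀ (by linarith)]
  constructor <;> intro h <;> linarith

theorem size_eq_maxSize_iff (hn : 2 ≤ n) (ht : 0 < t) :
    size n t = maxSize n ↔ t ^ 2 * ((n : ℝ) - 1) = n := by
  have hn0 : (2 : ℝ) ≤ n := by exact_mod_cast hn
  rw [size, maxSize, pow_left_inj₀ (by positivity) (by positivity) (by omega), eq_comm,
    Real.sqrt_eq_iff_eq_sq (div_nonneg (by linarith) (by linarith)) (by positivity),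
    two_mul_sq_eq, div_eq_iff (by linarith)]
  constructor <;> intro h <;> linarith

end size

/-- The constant that turns sizes into densities. -/
noncomputable def sizeRatio (n : ℕ) : ℝ := unitRatio n / √2 ^ (n - 1)

theorem sizeRatio_pos {n : ℕ} (hn : 2 ≤ n) : 0 < sizeRatio n :=
  div_pos (unitRatio_pos hn) (by positivity)

/-! ### Arrangements described by their sizes -/

namespace IsNormalized

variable {n : ℕ} {u : Fin (n + 1) → LVec n} {t : Fin (n + 1) → ℝ}

theorem isAdmissible_iff (hu : IsNormalized u) (hn : 2 ≤ n) (ht : ∀ i, 0 < t i) :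
    IsAdmissible u (fun i => horo (u i) (t i)) ↔
      (∀ i j, i ≠ j → size n (t i) * size n (t j) ≤ 1) ∧ ∀ i, size n (t i) ≤ maxSize n := by
  constructor
  · intro h
    exact ⟨fun i j hij => (size_mul_le_one_iff hn (ht i) (ht j)).2
        ((hu.disjoint_interior_iff hij (ht i) (ht j)).1 (h.packing i j hij)),
      fun i => (size_le_maxSize_iff hn (ht i)).2
        ((hu.encard_face_le_one_iff hn i (ht i)).1 (h.face i))⟩
  · rintro ⟨h1, h2⟩
    exact ⟨fun i => ⟨t i, ht i, rfl⟩, fun i j hij => (hu.disjoint_interior_iff hij (ht i) (ht j)).2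
        ((size_mul_le_one_iff hn (ht i) (ht j)).1 (h1 i j hij)),
      fun i => (hu.encard_face_le_one_iff hn i (ht i)).2
        ((size_le_maxSize_iff hn (ht i)).1 (h2 i))⟩

theorem isOneMaximal_iff (hu : IsNormalized u) (hn : 2 ≤ n) (ht : ∀ i, 0 < t i)
    (k : Fin (n + 1)) :
    IsOneMaximal u k (fun i => horo (u i) (t i)) ↔
      size n (t k) = maxSize n ∧ ∀ i, i ≠ k → size n (t i) = 1 / maxSize n := by
  have hM := maxSize_pos hn
  constructor
  · intro h
    have hk := (size_eq_maxSize_iff hn (ht k)).2 ((hu.touch_face_iff hn k (ht k)).1 h.touch_face)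
    refine ⟨hk, fun i hi => ?_⟩
    have := (size_mul_eq_one_iff hn (ht i) (ht k)).2
      ((hu.touch_iff hi (ht i) (ht k)).1 (h.touch i hi))
    rwa [eq_div_iff hM.ne', ← hk]
  · rintro ⟨hk, hi⟩
    refine ⟨fun i => ⟨t i, ht i, rfl⟩, ?_, fun i hik => ?_⟩
    · exact (hu.touch_face_iff hn k (ht k)).2 ((size_eq_maxSize_iff hn (ht k)).1 hk)
    · refine (hu.touch_iff hik (ht i) (ht k)).2 ((size_mul_eq_one_iff hn (ht i) (ht k)).1 ?_)
      rw [hk, hi i hik, one_div_mul_cancel hM.ne']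

/-- Pairwise tangency of three horoballs already forces all sizes to be 1; `same_type` matters only
in the converse. -/
theorem isEqualType_iff (hu : IsNormalized u) (hn : 2 ≤ n) (ht : ∀ i, 0 < t i) :
    IsEqualType u (fun i => horo (u i) (t i)) ↔ ∀ i, size n (t i) = 1 := by
  constructor
  · intro h i
    have hm : ∀ i j, i ≠ j → size n (t i) * size n (t j) = 1 := fun i j hij =>
      (size_mul_eq_one_iff hn (ht i) (ht j)).2
        ((hu.touch_iff hij (ht i) (ht j)).1 (h.touch i j hij))
    obtain ⟨j, k, hj, hk, hjk⟩ := exists_ne_ne hn i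
    have h1 := hm j i hj
    have h2 := hm k i hk
    have h3 := hm j k hjk
    have hpos := size_pos (n := n) (ht i)
    have hpos' := size_pos (n := n) (ht j)
    have h4 : size n (t j) = size n (t k) := mul_right_cancel₀ hpos.ne' (h1.trans h2.symm)
    rw [← h4, ← pow_two, pow_eq_one_iff_of_nonneg hpos'.le two_ne_zero] at h3
    rwa [h3, one_mul] at h1
  · intro h
    have hn0 : (2 : ℝ) ≤ n := by exact_mod_cast hn
    have hface : ∀ i, t i ^ 2 * ((n : ℝ) - 1) ≤ n := fun i =>
      (size_le_maxSize_iff hn (ht i)).1 (by linarith [h i, le_maxSize hn])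
    have heq : ∀ i j, t i = t j := fun i j => (size_inj hn (ht i) (ht j)).1 (by rw [h, h])
    refine ⟨fun i => ⟨t i, ht i, rfl⟩, fun i j => ?_, fun i j hij => ?_⟩
    · rw [hu.hypVol_horo_inter hn i (ht i) (hface i), hu.hypVol_horo_inter hn j (ht j) (hface j),
        heq i j]
    · refine (hu.touch_iff hij (ht i) (ht j)).2 ((size_mul_eq_one_iff hn (ht i) (ht j)).1 ?_)
      rw [h, h, one_mul]

theorem ratio_eq_size_mul (hu : IsNormalized u) (hn : 2 ≤ n) (i : Fin (n + 1)) {s : ℝ}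
    (hs : 0 < s) (hs' : size n s ≤ maxSize n) :
    (hypVol (horo (u i) s ∩ simplex u)).toReal / (hypVol (simplex u)).toReal =
      size n s * sizeRatio n := by
  rw [hu.ratio_eq hn i hs ((size_le_maxSize_iff hn hs).1 hs'), sizeRatio, size_eq_mul]
  field_simp

theorem density_eq_sum_size (hu : IsNormalized u) (hn : 2 ≤ n) (ht : ∀ i, 0 < t i)
    (ht' : ∀ i, size n (t i) ≤ maxSize n) :
    density u (fun i => horo (u i) (t i)) = (∑ i, size n (t i)) * sizeRatio n := by
  rw [density, Finset.sum_div, Finset.sum_mul]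
  exact Finset.sum_congr rfl fun i _ => hu.ratio_eq_size_mul hn i (ht i) (ht' i)

theorem exists_horo {B : Fin (n + 1) → Set (Hyp n)} (h : ∀ i, IsHoroball (u i) (B i)) :
    ∃ t : Fin (n + 1) → ℝ, (∀ i, 0 < t i) ∧ B = fun i => horo (u i) (t i) := by
  choose t ht hB using h
  exact ⟨t, ht, funext hB⟩

theorem existsUnique_of_size_iff (hn : 2 ≤ n) (P : (Fin (n + 1) → Set (Hyp n)) → Prop)
    (x : Fin (n + 1) → ℝ) (hx : ∀ i, 0 < x i) (hP : ∀ B, P B → ∀ i, IsHoroball (u i) (B i))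
    (h : ∀ t : Fin (n + 1) → ℝ, (∀ i, 0 < t i) →
      (P (fun i => horo (u i) (t i)) ↔ ∀ i, size n (t i) = x i)) : ∃! B, P B := by
  choose t ht hsize using fun i => exists_size_eq hn (hx i)
  refine ⟨fun i => horo (u i) (t i), (h t ht).2 hsize, fun B hB => ?_⟩
  obtain ⟨s, hs, rfl⟩ := exists_horo (hP B hB)
  have hs' := (h s hs).1 hB
  funext i
  rw [(size_inj hn (hs i) (ht i)).1 ((hs' i).trans (hsize i).symm)]

theorem existsUnique_isEqualType (hu : IsNormalized u) (hn : 2 ≤ n) :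
    ∃! B, IsEqualType u B :=
  existsUnique_of_size_iff hn _ (fun _ => 1) (fun _ => one_pos) (fun _ hB => hB.horoball)
    fun _ ht => hu.isEqualType_iff hn ht

theorem existsUnique_isOneMaximal (hu : IsNormalized u) (hn : 2 ≤ n) (k : Fin (n + 1)) :
    ∃! B, IsOneMaximal u k B := by
  have hM := maxSize_pos hn
  refine existsUnique_of_size_iff hn _ (fun i => if i = k then maxSize n else 1 / maxSize n)
    (fun i => ?_) (fun _ hB => hB.horoball) fun t ht => ?_
  · split_ifs <;> positivity
  · rw [hu.isOneMaximal_iff hn ht]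
    constructor
    · rintro ⟨h1, h2⟩ i
      split_ifs with hi
      · rw [hi, h1]
      · exact h2 i hi
    · intro h
      exact ⟨by simpa using h k, fun i hi => by simpa [hi] using h i⟩

theorem sum_size_of_oneMaximal {k : Fin (n + 1)} (hk : size n (t k) = maxSize n)
    (hi : ∀ i, i ≠ k → size n (t i) = 1 / maxSize n) :
    ∑ i, size n (t i) = maxSize n + n / maxSize n := by
  rw [← Finset.add_sum_erase _ _ (Finset.mem_univ k), hk,
    Finset.sum_congr rfl fun i hik => hi i (Finset.ne_of_mem_erase hik), Finset.sum_const,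
    Finset.card_erase_of_mem (Finset.mem_univ k), Finset.card_univ, Fintype.card_fin,
    nsmul_eq_mul, Nat.add_sub_cancel, mul_one_div]

theorem isAdmissible_of_oneMaximal (hu : IsNormalized u) (hn : 2 ≤ n) (ht : ∀ i, 0 < t i)
    {k : Fin (n + 1)} (hk : size n (t k) = maxSize n)
    (hi : ∀ i, i ≠ k → size n (t i) = 1 / maxSize n) :
    IsAdmissible u (fun i => horo (u i) (t i)) := by
  have hn0 : (2 : ℝ) ≤ n := by exact_mod_cast hn
  have hM := maxSize_pos hn
  have hM1 : 1 ≤ maxSize n := by linarith [le_maxSize hn]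
  have hM2 : 1 / maxSize n ≤ 1 := by
    rw [div_le_one hM]
    exact hM1
  refine (hu.isAdmissible_iff hn ht).2 ⟨fun i j hij => ?_, fun i => ?_⟩
  · by_cases hik : i = k
    · rw [hik, hk, hi j (fun h => hij (hik.trans h.symm)), mul_one_div_cancel hM.ne']
    · by_cases hjk : j = k
      · rw [hjk, hk, hi i hik, one_div_mul_cancel hM.ne']
      · rw [hi i hik, hi j hjk]
        exact mul_le_one₀ hM2 (by positivity) hM2
  · by_cases hik : i = k
    · rw [hik, hk]
    · rw [hi i hik]
      linarith

theorem isOptimal_iff_sum (hu : IsNormalized u) (hn : 2 ≤ n) (ht : ∀ i, 0 < t i) :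
    IsOptimal u (fun i => horo (u i) (t i)) ↔
      IsAdmissible u (fun i => horo (u i) (t i)) ∧
        ∑ i, size n (t i) = maxSize n + n / maxSize n := by
  have hK := sizeRatio_pos hn
  have hbound : ∀ s : Fin (n + 1) → ℝ, (∀ i, 0 < s i) →
      IsAdmissible u (fun i => horo (u i) (s i)) →
      ∑ i, size n (s i) ≤ maxSize n + n / maxSize n := fun s hs hB => by
    obtain ⟨h1, h2⟩ := (hu.isAdmissible_iff hn hs).1 hB
    exact (sum_le_of_pairwise_mul_le_one hn (le_maxSize hn) (fun i => size_pos (hs i)) h1 h2).1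
  have hdens : ∀ s : Fin (n + 1) → ℝ, (∀ i, 0 < s i) →
      IsAdmissible u (fun i => horo (u i) (s i)) →
      density u (fun i => horo (u i) (s i)) = (∑ i, size n (s i)) * sizeRatio n :=
    fun s hs hB => hu.density_eq_sum_size hn hs ((hu.isAdmissible_iff hn hs).1 hB).2
  constructor
  · rintro ⟨hadm, hmax⟩
    refine ⟨hadm, le_antisymm (hbound t ht hadm) ?_⟩
    -- The one-large-horoball arrangement is admissible and attains the bound, so an optimal
    -- arrangement must attain it too.
    obtain ⟨B, hB, -⟩ := hu.existsUnique_isOneMaximal hn 0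
    obtain ⟨s, hs, rfl⟩ := exists_horo hB.horoball
    obtain ⟨h1, h2⟩ := (hu.isOneMaximal_iff hn hs 0).1 hB
    have hs' := hu.isAdmissible_of_oneMaximal hn hs h1 h2
    have := hmax _ hs'
    rw [hdens s hs hs', hdens t ht hadm, sum_size_of_oneMaximal h1 h2] at this
    exact le_of_mul_le_mul_right this hK
  · rintro ⟨hadm, hsum⟩
    refine ⟨hadm, fun B' hB' => ?_⟩
    obtain ⟨s, hs, rfl⟩ := exists_horo hB'.horoball
    rw [hdens s hs hB', hdens t ht hadm, hsum]
    exact mul_le_mul_of_nonneg_right (hbound s hs hB') hK.le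

theorem isOptimal_iff (hu : IsNormalized u) (hn : 2 ≤ n) (B : Fin (n + 1) → Set (Hyp n)) :
    IsOptimal u B ↔ (maxSize n = n ∧ IsEqualType u B) ∨ ∃ k, IsOneMaximal u k B := by
  have hn0 : (2 : ℝ) ≤ n := by exact_mod_cast hn
  constructor
  · intro h
    obtain ⟨t, ht, rfl⟩ := exists_horo h.1.horoball
    obtain ⟨hadm, hsum⟩ := (hu.isOptimal_iff_sum hn ht).1 h
    obtain ⟨h1, h2⟩ := (hu.isAdmissible_iff hn ht).1 hadm
    rcases (sum_le_of_pairwise_mul_le_one hn (le_maxSize hn) (fun i => size_pos (ht i)) h1 h2).2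
      hsum with ⟨hM, h⟩ | ⟨k, hk, hi⟩
    · exact Or.inl ⟨hM, (hu.isEqualType_iff hn ht).2 h⟩
    · exact Or.inr ⟨k, (hu.isOneMaximal_iff hn ht k).2 ⟨hk, hi⟩⟩
  · rintro (⟨hM, h⟩ | ⟨k, h⟩)
    · obtain ⟨t, ht, rfl⟩ := exists_horo h.horoball
      have hs := (hu.isEqualType_iff hn ht).1 h
      refine (hu.isOptimal_iff_sum hn ht).2 ⟨(hu.isAdmissible_iff hn ht).2
        ⟨fun i j _ => by rw [hs, hs, one_mul], fun i => by rw [hs, hM]; linarith⟩, ?_⟩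
      rw [Finset.sum_congr rfl fun i _ => hs i, hM, div_self (by linarith)]
      simp
    · obtain ⟨t, ht, rfl⟩ := exists_horo h.horoball
      obtain ⟨hk, hi⟩ := (hu.isOneMaximal_iff hn ht k).1 h
      exact (hu.isOptimal_iff_sum hn ht).2
        ⟨hu.isAdmissible_of_oneMaximal hn ht hk hi, sum_size_of_oneMaximal hk hi⟩

theorem hdist_tangency (hu : IsNormalized u) (hn : 2 ≤ n) {B₀ B₁ : Fin (n + 1) → Set (Hyp n)}
    {i k : Fin (n + 1)} {p₀ p₁ : Hyp n} (h₀ : IsEqualType u B₀) (h₁ : IsOneMaximal u k B₁)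
    (hik : i ≠ k) (hp₀ : B₀ i ∩ B₀ k = {p₀}) (hp₁ : B₁ i ∩ B₁ k = {p₁}) :
    hdist p₀ p₁ = q n := by
  have hn0 : (2 : ℝ) ≤ n := by exact_mod_cast hn
  obtain ⟨t, ht, rfl⟩ := exists_horo h₀.horoball
  obtain ⟨s, hs, rfl⟩ := exists_horo h₁.horoball
  have hm₀ : p₀ ∈ horo (u i) (t i) ∩ horo (u k) (t k) := hp₀ ▸ rfl
  have hm₁ : p₁ ∈ horo (u i) (s i) ∩ horo (u k) (s k) := hp₁ ▸ rfl
  have htt : t i * t k = 1 / 2 := (hu.touch_iff hik (ht i) (ht k)).1 (h₀.touch i k hik)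
  have hss : s i * s k = 1 / 2 := (hu.touch_iff hik (hs i) (hs k)).1 (h₁.touch i hik)
  have hsk : s k ^ 2 * ((n : ℝ) - 1) = n := (hu.touch_face_iff hn k (hs k)).1 h₁.touch_face
  have hteq : t k = t i := by
    have h := (hu.isEqualType_iff hn ht).1 h₀
    exact (size_inj hn (ht k) (ht i)).1 (by rw [h, h])
  have e₀ := hu.val_eq_of_mem_inter hik htt.le hm₀.1 hm₀.2
  have e₁ := hu.val_eq_of_mem_inter hik hss.le hm₁.1 hm₁.2
  have hlor : -(lor p₀.1 p₁.1) = t i * (s i + s k) := by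
    obtain ⟨g1, g2, -⟩ := hu.lor_comb hik (s k) (s i)
    rw [e₀, e₁, lor_add_left, lor_smul_left, lor_smul_left, lor_comm (u i), lor_comm (u k), g1, g2,
      hteq]
    ring
  set L := √(2 * n / ((n : ℝ) - 1)) with hL
  have hti : √2 * t i = 1 := by
    rw [hteq, ← pow_two] at htt
    have : (√2 * t i) ^ 2 = 1 := by rw [two_mul_sq_eq, htt]; norm_num
    exact (pow_eq_one_iff_of_nonneg (by have := ht i; positivity) two_ne_zero).1 this
  have hLs : L = √2 * s k := by
    rw [hL, Real.sqrt_eq_iff_eq_sq (div_nonneg (by linarith) (by linarith))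
      (by have := hs k; positivity), two_mul_sq_eq, div_eq_iff (by linarith)]
    linarith
  have hL1 : 1 ≤ L := by
    rw [hL, Real.one_le_sqrt, le_div_iff₀ (by linarith)]
    linarith
  -- With √2 t_i = 1, √2 s_k = L and √2 s_i = 1/L, the product is (L + 1/L)/2.
  have hcosh : t i * (s i + s k) = Real.cosh (Real.log L) := by
    rw [Real.cosh_log (by linarith)]
    have h2 : √2 * √2 = 2 := Real.mul_self_sqrt zero_le_two
    have e1 : t i = √2 / 2 := by
      have : √2 * (√2 * t i) = √2 * 1 := by rw [hti]
      rw [← mul_assoc, h2] at this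
      linarith
    have e2 : L⁻¹ = √2 * s i := by
      rw [inv_eq_iff_eq_inv, eq_comm, inv_eq_of_mul_eq_one_left]
      rw [hLs, mul_mul_mul_comm, h2, mul_comm (s k), hss]
      norm_num
    rw [e2, hLs, e1]
    ring
  rw [hdist, hlor, hcosh, Real.arcosh_cosh (Real.log_nonneg hL1), q, hL]

theorem classical_ratio (hu : IsNormalized u) (hn : 2 ≤ n) {B : Fin (n + 1) → Set (Hyp n)}
    (h : IsEqualType u B) (i : Fin (n + 1)) :
    (hypVol (B i ∩ simplex u)).toReal / (hypVol (simplex u)).toReal = sizeRatio n := by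
  have hn0 : (2 : ℝ) ≤ n := by exact_mod_cast hn
  obtain ⟨t, ht, rfl⟩ := exists_horo h.horoball
  have hs := (hu.isEqualType_iff hn ht).1 h i
  rw [hu.ratio_eq_size_mul hn i (ht i) (by rw [hs]; linarith [le_maxSize hn]), hs, one_mul]

end IsNormalized

/-! ### Independence of the representatives of the vertices -/

section rescaling

variable {n : ℕ} {E : Fin (n + 1) → LVec n} {c : Fin (n + 1) → ℝ}

theorem isHoroball_smul_iff {e : LVec n} {r : ℝ} (hr : 0 < r) (B : Set (Hyp n)) :
    IsHoroball (r • e) B ↔ IsHoroball e B := by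
  constructor
  · rintro ⟨t, ht, rfl⟩
    refine ⟨t / r, by positivity, ?_⟩
    ext x
    rw [Set.mem_ofPred_eq, Set.mem_ofPred_eq, lor_smul_right, le_div_iff₀ hr]
    constructor <;> intro h <;> linarith
  · rintro ⟨t, ht, rfl⟩
    refine ⟨r * t, by positivity, ?_⟩
    ext x
    rw [Set.mem_ofPred_eq, Set.mem_ofPred_eq, lor_smul_right, ← mul_neg,
      mul_le_mul_iff_of_pos_left hr]

theorem simplex_smul (hc : ∀ i, 0 < c i) : simplex (fun i => c i • E i) = simplex E := by
  ext x
  constructor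
  · rintro ⟨a, ha, hx⟩
    refine ⟨fun i => a i * c i, fun i => mul_nonneg (ha i) (hc i).le, ?_⟩
    rw [hx]
    exact Finset.sum_congr rfl fun i _ => by rw [smul_smul]
  · rintro ⟨a, ha, hx⟩
    refine ⟨fun i => a i / c i, fun i => div_nonneg (ha i) (hc i).le, ?_⟩
    rw [hx]
    exact Finset.sum_congr rfl fun i _ => by rw [smul_smul, div_mul_cancel₀ _ (hc i).ne']

theorem oppositeHyperplane_smul (hc : ∀ i, 0 < c i) (i : Fin (n + 1)) :
    oppositeHyperplane (fun i => c i • E i) i = oppositeHyperplane E i := by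
  have h : Submodule.span ℝ ((fun i => c i • E i) '' {j | j ≠ i}) =
      Submodule.span ℝ (E '' {j | j ≠ i}) := by
    refine le_antisymm (Submodule.span_le.2 ?_) (Submodule.span_le.2 ?_)
    · rintro _ ⟨j, hj, rfl⟩
      exact Submodule.smul_mem _ _ (Submodule.subset_span ⟨j, hj, rfl⟩)
    · rintro _ ⟨j, hj, rfl⟩
      have : (c j)⁻¹ • c j • E j ∈ Submodule.span ℝ ((fun i => c i • E i) '' {j | j ≠ i}) :=
        Submodule.smul_mem _ _ (Submodule.subset_span ⟨j, hj, rfl⟩)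
      rwa [smul_smul, inv_mul_cancel₀ (hc j).ne', one_smul] at this
  rw [oppositeHyperplane, oppositeHyperplane, h]

theorem density_smul (hc : ∀ i, 0 < c i) : density (fun i => c i • E i) = density E := by
  funext B
  rw [density, density, simplex_smul hc]

theorem isAdmissible_smul (hc : ∀ i, 0 < c i) :
    IsAdmissible (fun i => c i • E i) = IsAdmissible E := by
  funext B
  refine propext ⟨fun h => ⟨fun i => (isHoroball_smul_iff (hc i) _).1 (h.horoball i), h.packing,
    fun i => ?_⟩, fun h => ⟨fun i => (isHoroball_smul_iff (hc i) _).2 (h.horoball i), h.packing,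
    fun i => ?_⟩⟩
  · simpa only [oppositeHyperplane_smul hc] using h.face i
  · simpa only [oppositeHyperplane_smul hc] using h.face i

theorem isOptimal_smul (hc : ∀ i, 0 < c i) :
    IsOptimal (fun i => c i • E i) = IsOptimal E := by
  funext B
  rw [IsOptimal, IsOptimal, isAdmissible_smul hc, density_smul hc]

theorem isEqualType_smul (hc : ∀ i, 0 < c i) :
    IsEqualType (fun i => c i • E i) = IsEqualType E := by
  funext B
  refine propext ⟨fun h => ⟨fun i => (isHoroball_smul_iff (hc i) _).1 (h.horoball i), ?_, h.touch⟩,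
    fun h => ⟨fun i => (isHoroball_smul_iff (hc i) _).2 (h.horoball i), ?_, h.touch⟩⟩
  · simpa only [simplex_smul hc] using h.same_type
  · simpa only [simplex_smul hc] using h.same_type

theorem isOneMaximal_smul (hc : ∀ i, 0 < c i) :
    IsOneMaximal (fun i => c i • E i) = IsOneMaximal E := by
  funext k B
  refine propext ⟨fun h => ⟨fun i => (isHoroball_smul_iff (hc i) _).1 (h.horoball i), ?_, h.touch⟩,
    fun h => ⟨fun i => (isHoroball_smul_iff (hc i) _).2 (h.horoball i), ?_, h.touch⟩⟩
  · simpa only [oppositeHyperplane_smul hc] using h.touch_face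
  · simpa only [oppositeHyperplane_smul hc] using h.touch_face

end rescaling

/-! ### Comparison with the classical density -/

theorem isClassicalDensity_iff {n : ℕ} (hn : 2 ≤ n) {E : Fin (n + 1) → LVec n}
    (hE : IsRegularIdealSimplex E) (d : ℝ) :
    IsClassicalDensity n d ↔ d = (n + 1) * sizeRatio n := by
  have key : ∀ {E : Fin (n + 1) → LVec n} {B : Fin (n + 1) → Set (Hyp n)},
      IsRegularIdealSimplex E → IsEqualType E B → ∀ i,
        (hypVol (B i ∩ simplex E)).toReal / (hypVol (simplex E)).toReal = sizeRatio n := by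
    intro E B hE hB i
    obtain ⟨c, hc, hu⟩ := hE.exists_isNormalized hn
    rw [← isEqualType_smul hc] at hB
    have := hu.classical_ratio hn hB i
    rwa [simplex_smul hc] at this
  constructor
  · rintro ⟨E', B, hE', hB, hd⟩
    rw [hd 0, key hE' hB]
  · rintro rfl
    obtain ⟨c, hc, hu⟩ := hE.exists_isNormalized hn
    obtain ⟨B, hB, -⟩ := hu.existsUnique_isEqualType hn
    rw [isEqualType_smul hc] at hB
    exact ⟨E, B, hE, hB, fun i => by rw [key hE hB]⟩

theorem IsNormalized.classical_lt_density {n : ℕ} {u : Fin (n + 1) → LVec n}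
    (hu : IsNormalized u) (hn : 4 ≤ n) {B : Fin (n + 1) → Set (Hyp n)} (hB : IsOptimal u B) :
    (n + 1) * sizeRatio n < density u B := by
  have hn0 : (4 : ℝ) ≤ n := by exact_mod_cast hn
  have hn2 : 2 ≤ n := by omega
  obtain ⟨t, ht, rfl⟩ := exists_horo hB.1.horoball
  rw [hu.density_eq_sum_size hn2 ht ((hu.isAdmissible_iff hn2 ht).1 hB.1).2,
    ((hu.isOptimal_iff_sum hn2 ht).1 hB).2]
  refine mul_lt_mul_of_pos_right ?_ (sizeRatio_pos hn2)
  have hM := lt_maxSize hn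
  have hM0 : 0 < maxSize n := by linarith
  -- The gap between the optimal size sum and that of the equal arrangement, positive because M > n.
  have hid : maxSize n + n / maxSize n - (n + 1) =
      (maxSize n - 1) * (maxSize n - n) / maxSize n := by
    field_simp
    ring
  have : 0 < (maxSize n - 1) * (maxSize n - n) / maxSize n :=
    div_pos (mul_pos (by linarith) (by linarith)) hM0
  linarith

end HoroballSimplex

theorem theorem3p6 (n : ℕ) (hn : 2 ≤ n) (E : Fin (n + 1) → HoroballSimplex.LVec n)
    (hE : HoroballSimplex.IsRegularIdealSimplex E) :
    -- the density is well defined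
    (0 < HoroballSimplex.hypVol (HoroballSimplex.simplex E) ∧
      HoroballSimplex.hypVol (HoroballSimplex.simplex E) < ⊤) ∧
    -- the two basic configurations exist and are uniquely determined
    (∃! B, HoroballSimplex.IsEqualType E B) ∧
    (∀ k, ∃! B, HoroballSimplex.IsOneMaximal E k B) ∧
    -- `q n` is the distance between their tangency points on an edge at the large horoball
    (∀ B₀ B₁ k i p₀ p₁, HoroballSimplex.IsEqualType E B₀ → HoroballSimplex.IsOneMaximal E k B₁ →
      i ≠ k → B₀ i ∩ B₀ k = {p₀} → B₁ i ∩ B₁ k = {p₁} →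
      HoroballSimplex.hdist p₀ p₁ = HoroballSimplex.q n) ∧
    -- the optimal configurations
    (n = 2 ∨ n = 3 →
      HoroballSimplex.q n = 1 / ((n : ℝ) - 1) * Real.log n ∧
      ∀ B, HoroballSimplex.IsOptimal E B ↔
        HoroballSimplex.IsEqualType E B ∨ ∃ k, HoroballSimplex.IsOneMaximal E k B) ∧
    (4 ≤ n →
      1 / ((n : ℝ) - 1) * Real.log n < HoroballSimplex.q n ∧
      ∀ B, HoroballSimplex.IsOptimal E B ↔ ∃ k, HoroballSimplex.IsOneMaximal E k B) ∧
    -- the congruent-horoball bound is exceeded from dimension four on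
    (∃! d, HoroballSimplex.IsClassicalDensity n d) ∧
    (4 ≤ n → ∀ d, HoroballSimplex.IsClassicalDensity n d →
      ∀ B, HoroballSimplex.IsOptimal E B → d < HoroballSimplex.density E B) := by
  open HoroballSimplex in
  obtain ⟨c, hc, hu⟩ := hE.exists_isNormalized hn
  rw [← simplex_smul hc, ← isEqualType_smul hc, ← isOneMaximal_smul hc, ← isOptimal_smul hc,
    ← density_smul hc]
  refine ⟨⟨?_, ?_⟩, hu.existsUnique_isEqualType hn, hu.existsUnique_isOneMaximal hn,
    fun B₀ B₁ k i p₀ p₁ h₀ h₁ hik hp₀ hp₁ => hu.hdist_tangency hn h₀ h₁ hik hp₀ hp₁,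
    fun h => ⟨q_eq h, fun B => ?_⟩, fun h => ⟨lt_q h, fun B => ?_⟩, ?_, fun h d hd B hB => ?_⟩
  · rw [hu.hypVol_simplex]
    exact ENNReal.mul_pos hu.volFactor_pos.ne' (volume_coordCone_pos hn).ne'
  · rw [hu.hypVol_simplex]
    exact ENNReal.mul_lt_top (volFactor_lt_top _) (volume_coordCone_lt_top hn)
  · rw [hu.isOptimal_iff hn, and_iff_right (maxSize_eq h)]
  · rw [hu.isOptimal_iff hn, or_iff_right fun hc => (lt_maxSize h).ne' hc.1]
  · exact ⟨_, (isClassicalDensity_iff hn hE _).2 rfl,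
      fun d hd => (isClassicalDensity_iff hn hE d).1 hd⟩
  · rw [(isClassicalDensity_iff hn hE d).1 hd]
    exact hu.classical_lt_density h hB
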